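/- Let $G$ be a discrete group, $H<G$ a finite normal subgroup, $G_0=G/H$, let $\rho:H\to GL(V)$ be an irreducible finite-dimensional complex representation such that for every $g\in G$ the representation $\rho_g(h)=\rho(g^{-1}hg)$ is equivalent to $\rho$, let $F$ be a finite-dimensional complex vector space, and let $u:G\to H$ be a map with $u(gh)=u(g)h$ for $h\in H$ and $u(1)=1$. The canonical model is $G_0\times(F\otimes V)$ with the action of $G$ $$g_1\cdot([g],w)=\bigl([g_1g],\,(\mathrm{Id}\otimes\rho(u(g_1g)u(g)^{-1}))w\bigr).$$ Let $\mathrm{Aut}_G(G_0\times(F\otimes V))$ be the topological group (pointwise convergence) of its $G$-equivariant automorphisms as a vector bundle over the discrete space $G_0$, and let $pr:\mathrm{Aut}_G(G_0\times(F\otimes V))\to \mathrm{Aut}_G(G_0)\cong G_0$ be the homomorphism that sends an automorphism to its base map (the right translation by $a$ corresponds to $a^{-1}\in G_0$). For a principal $G_0$-bundle $M\to X$, let $\mathrm{Vect}_G(M,\rho)$ consist of the $G$-vector bundles $\xi=\xi_0\otimes V$ over $M$, where $\xi_0$ is a complex vector bundle over $M$ with fibre $F$ and $V$ is the trivial bundle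 with fibre $V$, on which $G$ acts by homeomorphisms that are linear on fibres and cover the free action of $G_0$ on $M$, and on which $H$ acts by $\mathrm{Id}\otimes\rho$. Let $\bigsqcup_M \mathrm{Vect}_G(M,\rho)$, over all principal $G_0$-bundles $M\to X$ (isomorphic $M$ being identified), be the category of pairs $(M,\xi)$, $\xi\in\mathrm{Vect}_G(M,\rho)$, whose morphisms are the $G$-equivariant vector bundle isomorphisms covering an isomorphism of principal $G_0$-bundles over $X$. Let $\mathrm{Bundle}(X,L)$ be the category of principal $L$-bundles over $X$ and bundle maps over $\mathrm{id}_X$. Theorem. Let $X$ be compact. There is an equivalence of categories $$\mathrm{Bundle}\bigl(X,\mathrm{Aut}_G(G_0\times(F\otimes V))\bigr)\;\approx\;\bigsqcup_{M\in \mathrm{Bundle}(X,G_0)}\mathrm{Vect}_G(M,\rho),$$ in particular a bijection of isomorphism classes, with the following description. If $P$ is a principal bundle with transition functions $\Psi_{\alpha\beta}:U_\alpha\cap U_\beta\to \mathrm{Aut}_G(G_0\times(F\otimes V))$ and $(M,\xi)$ corresponds to $P$, then $M$ has the transition functions $pr\circ\Psi_{\alpha\beta}$; and a pair $(M',\xi')$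 is isomorphic to $(M,\xi)$ if and only if $M'$ is a principal $G_0$-bundle with transition functions $pr\circ\Psi_{\alpha\beta}$ and, over it, $\xi'$ is glued $G$-equivariantly from the canonical models $U_\alpha\times(G_0\times(F\otimes V))$ along $\Psi_{\alpha\beta}$. Moreover, if $\rho$ is non-trivial, then for every such $\xi$ the only vectors of $\xi$ fixed by $H$ are the zero vectors, so that the action of $G$ is quasi-free over the base with stationary subgroup $H$. -/

import Mathlib

open CategoryTheory Topology
open scoped TensorProduct

universe u

/-! ### Principal bundles -/

/-- A principal `L`-bundle over `X`: a space over `X` with a continuous fibrewise action of `L`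
(written on the left) that is locally, over `X`, equivariantly homeomorphic to `U × L` with `L`
acting on itself by left translations. -/
structure PrincipalBundle (X L : Type u) [TopologicalSpace X] [TopologicalSpace L] [Group L] :
    Type (u + 1) where
  /-- the total space -/
  Total : Type u
  [topTotal : TopologicalSpace Total]
  [act : MulAction L Total]
  [contAct : ContinuousSMul L Total]
  /-- the projection to the base -/
  proj : Total → X
  continuous_proj : Continuous proj
  proj_smul : ∀ (l : L) (p : Total), proj (l • p) = proj p
  locally_trivial : ∀ x : X, ∃ e : Bundle.Trivialization L proj, x ∈ e.baseSet ∧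
    ∀ (l : L) (p : Total), proj p ∈ e.baseSet → (e (l • p)).2 = l * (e p).2

attribute [instance] PrincipalBundle.topTotal PrincipalBundle.act PrincipalBundle.contAct

namespace PrincipalBundle

variable {X L : Type u} [TopologicalSpace X] [TopologicalSpace L] [Group L]

/-- Morphisms of principal bundles: continuous equivariant maps over the identity of `X`. -/
@[ext]
structure Hom (P Q : PrincipalBundle X L) : Type u where
  toFun : P.Total → Q.Total
  continuous_toFun : Continuous toFun
  map_smul : ∀ (l : L) (p : P.Total), toFun (l • p) = l • toFun p
  proj_toFun : ∀ p : P.Total, Q.proj (toFun p) = P.proj p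

/-- The category `Bundle(X, L)` of principal `L`-bundles over `X`. -/
instance : LargeCategory (PrincipalBundle X L) where
  Hom := Hom
  id P := ⟨fun p => p, continuous_id, fun _ _ => rfl, fun _ => rfl⟩
  comp f g := ⟨fun p => g.toFun (f.toFun p), g.continuous_toFun.comp f.continuous_toFun,
    fun l p => by rw [f.map_smul, g.map_smul], fun p => by rw [g.proj_toFun, f.proj_toFun]⟩

/-- `(U, Ψ)` is a cocycle of transition functions of `P`: the `U i` form an open cover of `X`, and
`P` has continuous sections `s i` over `U i` with `s j = Ψ i j • s i` over `U i ∩ U j`. (The values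
of `Ψ i j` outside `U i ∩ U j` are irrelevant.) -/
def HasCocycle (P : PrincipalBundle X L) {ι : Type u} (U : ι → Set X) (Ψ : ι → ι → X → L) :
    Prop :=
  (∀ i, IsOpen (U i)) ∧ (⋃ i, U i) = Set.univ ∧
    ∃ s : ι → X → P.Total,
      (∀ i, ContinuousOn (s i) (U i)) ∧
      (∀ i, ∀ x ∈ U i, P.proj (s i x) = x) ∧
      ∀ i j, ∀ x ∈ U i ∩ U j, s j x = Ψ i j x • s i x

end PrincipalBundle

/-! ### The canonical model and its automorphism group -/

section Model

variable {G : Type u} [Group G] (H : Subgroup G)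

/-- A map `u : G → H` of right `H`-modules with `u 1 = 1`. -/
structure RightModuleMap where
  toFun : G → H
  map_mul : ∀ (g : G) (h : H), toFun (g * h) = toFun g * h
  map_one : toFun 1 = 1

variable {H}
variable {V : Type u} [NormedAddCommGroup V] [InnerProductSpace ℂ V]

/-- The canonical model `G₀ × (F ⊗ V)`, where `G₀ = G ⧸ H`; it is a vector bundle over `G₀`. The
representation `ρ` and the map `c : G → H` enter in the action of `G`. -/
@[ext, nolint unusedArguments]
structure CanonicalModel (_ρ : Representation ℂ H V) (F : Type u) [NormedAddCommGroup F]
    [InnerProductSpace ℂ F] (_c : RightModuleMap H) : Type u where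
  base : G ⧸ H
  vec : F ⊗[ℂ] V

namespace CanonicalModel

variable (ρ : Representation ℂ H V) (F : Type u) [NormedAddCommGroup F] [InnerProductSpace ℂ F]
  (c : RightModuleMap H)

/-- The operator `φ([g], g₁) = Id ⊗ ρ (u(g₁ g) u(g)⁻¹)`, from the fibre over `[g]` to the fibre
over `[g₁ g]`, where `u` is the map `c : G → H`. -/
noncomputable def phi (g₁ : G) (q : G ⧸ H) : (F ⊗[ℂ] V) →ₗ[ℂ] (F ⊗[ℂ] V) :=
  Quotient.liftOn' q
    (fun g => LinearMap.lTensor F (ρ (c.toFun (g₁ * g) * (c.toFun g)⁻¹)))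
    (by
      intro a b hab
      obtain ⟨h, rfl⟩ : ∃ h : H, b = a * h :=
        ⟨⟨a⁻¹ * b, QuotientGroup.leftRel_apply.mp hab⟩, by simp⟩
      simp only [← mul_assoc, c.map_mul, mul_inv_rev]
      congr 2
      group)

theorem phi_mk (g₁ g : G) : phi ρ F c g₁ (QuotientGroup.mk g : G ⧸ H) =
    LinearMap.lTensor F (ρ (c.toFun (g₁ * g) * (c.toFun g)⁻¹)) := rfl

/-- The canonical action of `G`. -/
noncomputable instance : MulAction G (CanonicalModel ρ F c) where
  smul g₁ y := ⟨g₁ • y.base, phi ρ F c g₁ y.base y.vec⟩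
  one_smul y := by
    obtain ⟨q, w⟩ := y
    induction q using QuotientGroup.induction_on with
    | H g =>
      change (⟨(1 : G) • (g : G ⧸ H), phi ρ F c 1 (g : G ⧸ H) w⟩ : CanonicalModel ρ F c) = _
      rw [phi_mk, one_smul, one_mul, mul_inv_cancel, _root_.map_one, Module.End.one_eq_id,
        LinearMap.lTensor_id]
      rfl
  mul_smul a b y := by
    obtain ⟨q, w⟩ := y
    induction q using QuotientGroup.induction_on with
    | H g =>
      change (⟨(a * b) • (g : G ⧸ H), phi ρ F c (a * b) (g : G ⧸ H) w⟩ : CanonicalModel ρ F c) =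
        ⟨a • b • (g : G ⧸ H), phi ρ F c a ((b * g : G) : G ⧸ H) (phi ρ F c b (g : G ⧸ H) w)⟩
      rw [phi_mk, phi_mk, phi_mk, mul_smul, ← LinearMap.comp_apply, ← LinearMap.lTensor_comp,
        ← Module.End.mul_eq_comp, ← _root_.map_mul, mul_assoc a b g,
        mul_assoc (c.toFun (a * (b * g))), inv_mul_cancel_left]

@[simp]
theorem smul_base (g₁ : G) (y : CanonicalModel ρ F c) : (g₁ • y).base = g₁ • y.base := rfl

@[simp]
theorem smul_vec (g₁ : G) (y : CanonicalModel ρ F c) :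
    (g₁ • y).vec = phi ρ F c g₁ y.base y.vec := rfl

/-- For discrete `G`, the canonical model carries the product of the discrete topology of `G₀` and
the usual topology of the finite-dimensional space `F ⊗ V`. -/
noncomputable instance [TopologicalSpace G] : TopologicalSpace (CanonicalModel ρ F c) :=
  TopologicalSpace.induced (fun y => ((y.base, y.vec) : (G ⧸ H) × (F ⊗[ℂ] V))) inferInstance

/-- `Aut_G(G₀ × (F ⊗ V))`: the `G`-equivariant bijections of the canonical model that cover a
bijection `a` of `G₀` and are linear isomorphisms `A q` from the fibre over `q` to the fibre over
`a q`. (The map `a` is then automatically `G`-equivariant.) -/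
noncomputable def aut : Subgroup (Equiv.Perm (CanonicalModel ρ F c)) where
  carrier := {T |
    (∃ (a : Equiv.Perm (G ⧸ H)) (A : (G ⧸ H) → ((F ⊗[ℂ] V) ≃ₗ[ℂ] (F ⊗[ℂ] V))),
      ∀ q w, T ⟨q, w⟩ = ⟨a q, A q w⟩) ∧
    ∀ (g : G) (y : CanonicalModel ρ F c), T (g • y) = g • T y}
  one_mem' := ⟨⟨1, fun _ => LinearEquiv.refl ℂ _, fun _ _ => rfl⟩, fun _ _ => rfl⟩
  mul_mem' := by
    rintro S T ⟨⟨a, A, hA⟩, hS⟩ ⟨⟨b, B, hB⟩, hT⟩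
    refine ⟨⟨a * b, fun q => (B q).trans (A (b q)), fun q w => ?_⟩, fun g y => ?_⟩
    · rw [Equiv.Perm.mul_apply, hB, hA]; rfl
    · rw [Equiv.Perm.mul_apply, hT, hS]; rfl
  inv_mem' := by
    rintro T ⟨⟨a, A, hA⟩, hT⟩
    refine ⟨⟨a⁻¹, fun q => (A (a⁻¹ q)).symm, fun q w => ?_⟩, fun g y => ?_⟩
    · rw [Equiv.Perm.inv_eq_iff_eq, hA]
      simp
    · rw [Equiv.Perm.inv_eq_iff_eq, hT]
      simp

/-- The group `Aut_G(G₀ × (F ⊗ V))` as a type. -/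
abbrev Aut : Type u := aut ρ F c

/-- `Aut_G(G₀ × (F ⊗ V))` carries the topology of pointwise convergence. (The automorphisms being
linear on the finite-dimensional fibres over the discrete space `G₀`, this is also the compact-open
topology.) -/
noncomputable instance [TopologicalSpace G] : TopologicalSpace (Aut ρ F c) :=
  TopologicalSpace.induced
    (fun (T : Aut ρ F c) (y : CanonicalModel ρ F c) => (T : Equiv.Perm (CanonicalModel ρ F c)) y)
    inferInstance

theorem aut_apply_base [H.Normal] (T : Aut ρ F c) (y : CanonicalModel ρ F c) :
    ((T : Equiv.Perm (CanonicalModel ρ F c)) y).base =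
      y.base * ((T : Equiv.Perm (CanonicalModel ρ F c)) ⟨1, 0⟩).base := by
  obtain ⟨T, ⟨a, A, hA⟩, hT⟩ := T
  obtain ⟨q, w⟩ := y
  induction q using QuotientGroup.induction_on with
  | H g =>
    have h := congrArg CanonicalModel.base (hT g ⟨1, 0⟩)
    have h2 : g • (⟨1, 0⟩ : CanonicalModel ρ F c) = ⟨g • (1 : G ⧸ H), phi ρ F c g 1 0⟩ := rfl
    rw [smul_base, h2, hA, hA] at h
    change (T ⟨g, w⟩).base = (g : G ⧸ H) * (T ⟨1, 0⟩).base
    rw [hA, hA]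
    change a (g : G ⧸ H) = (g : G ⧸ H) * a 1
    change a (g • (1 : G ⧸ H)) = g • a 1 at h
    have h1 : g • (1 : G ⧸ H) = (g : G ⧸ H) := by
      change ((g * 1 : G) : G ⧸ H) = g
      rw [mul_one]
    rw [h1] at h
    rw [h]
    induction a 1 using QuotientGroup.induction_on with
    | H b => rfl

/-- The projection `pr : Aut_G(G₀ × (F ⊗ V)) → Aut_G(G₀) ≅ G₀`. The base map of `T` is the right
translation by some `a ∈ G₀`; right translations compose in the opposite order, so that the group
isomorphism `Aut_G(G₀) ≅ G₀` sends the translation by `a` to `a⁻¹`. -/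
noncomputable def pr [H.Normal] : Aut ρ F c →* G ⧸ H where
  toFun T := ((T : Equiv.Perm (CanonicalModel ρ F c)) ⟨1, 0⟩).base⁻¹
  map_one' := inv_one
  map_mul' S T := by
    rw [← mul_inv_rev, ← aut_apply_base]
    rfl

end CanonicalModel

end Model

/-! ### `G`-vector bundles `ξ₀ ⊗ V` with quasi-free action -/

section TensorBundle

variable (F V : Type u) [NormedAddCommGroup F] [InnerProductSpace ℂ F]
  [NormedAddCommGroup V] [InnerProductSpace ℂ V]

/-- The total space of `ξ₀ ⊗ V`, where `ξ₀` has the fibres `E m` and model fibre `F`, and `V` stands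
for the trivial bundle with fibre `V`. -/
abbrev TensorTotal {M : Type u} (E : M → Type u) [∀ m, AddCommGroup (E m)] [∀ m, Module ℂ (E m)] :
    Type u :=
  Bundle.TotalSpace (F ⊗[ℂ] V) (fun m => E m ⊗[ℂ] V)

/-- The topology of `ξ₀ ⊗ V`: it is glued from the products `U × (F ⊗ V)` along the maps
`(m, w) ↦ (e_m⁻¹ ⊗ id) w`, for all local trivializations `e` of `ξ₀` in its atlas, `U` being the
base set of `e`. -/
noncomputable instance tensorTopology {M : Type u} [TopologicalSpace M] (E : M → Type u)
    [∀ m, AddCommGroup (E m)] [∀ m, Module ℂ (E m)] [∀ m, TopologicalSpace (E m)]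
    [TopologicalSpace (Bundle.TotalSpace F E)] [FiberBundle F E] [VectorBundle ℂ F E] :
    TopologicalSpace (TensorTotal F V E) :=
  ⨆ (e : Bundle.Trivialization F (Bundle.TotalSpace.proj : Bundle.TotalSpace F E → M))
    (_ : MemTrivializationAtlas e),
    TopologicalSpace.coinduced
      (fun z : e.baseSet × (F ⊗[ℂ] V) =>
        (⟨z.1, LinearMap.rTensor V (e.symmₗ ℂ (z.1 : M)) z.2⟩ : TensorTotal F V E))
      inferInstance

end TensorBundle

section QuasiFree

variable {X G : Type u} [TopologicalSpace X] [TopologicalSpace G] [Group G]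
  {H : Subgroup G} [H.Normal]
  {V : Type u} [NormedAddCommGroup V] [InnerProductSpace ℂ V]

/-- An object of `Vect_G(M, ρ)`, for a principal `G₀`-bundle `M` over `X`, where `G₀ = G ⧸ H`: a
vector bundle `ξ₀` over (the total space of) `M` with fibre `F`, and an action of the discrete group
`G` on `ξ = ξ₀ ⊗ V` by homeomorphisms that are linear on the fibres and cover the (free) action of
`G₀` on `M`, such that `H` acts on `ξ` by `id ⊗ ρ`, i.e. trivially on `ξ₀` and through `ρ` on `V`. -/
structure VectG (ρ : Representation ℂ H V) (F : Type u) [NormedAddCommGroup F]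
    [InnerProductSpace ℂ F] (M : PrincipalBundle X (G ⧸ H)) : Type (u + 1) where
  /-- the fibres of `ξ₀` -/
  Fib : M.Total → Type u
  [addCommGroupFib : ∀ m, AddCommGroup (Fib m)]
  [moduleFib : ∀ m, Module ℂ (Fib m)]
  [topFib : ∀ m, TopologicalSpace (Fib m)]
  [topTotal : TopologicalSpace (Bundle.TotalSpace F Fib)]
  [fiberBundle : FiberBundle F Fib]
  [vectorBundle : VectorBundle ℂ F Fib]
  [act : MulAction G (TensorTotal F V Fib)]
  [contAct : ContinuousConstSMul G (TensorTotal F V Fib)]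
  smul_linear : ∀ (g : G) (m : M.Total),
    ∃ Φ : (Fib m ⊗[ℂ] V) →ₗ[ℂ] (Fib ((g : G ⧸ H) • m) ⊗[ℂ] V),
      ∀ w, g • (⟨m, w⟩ : TensorTotal F V Fib) = ⟨(g : G ⧸ H) • m, Φ w⟩
  smul_stationary : ∀ (h : H) (m : M.Total) (w : Fib m ⊗[ℂ] V),
    (h : G) • (⟨m, w⟩ : TensorTotal F V Fib) = ⟨m, LinearMap.lTensor (Fib m) (ρ h) w⟩

namespace VectG

attribute [instance] VectG.addCommGroupFib VectG.moduleFib VectG.topFib VectG.topTotal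
  VectG.fiberBundle VectG.vectorBundle VectG.act VectG.contAct

variable {ρ : Representation ℂ H V} {F : Type u} [NormedAddCommGroup F] [InnerProductSpace ℂ F]

/-- The total space of `ξ = ξ₀ ⊗ V`. -/
abbrev Total {M : PrincipalBundle X (G ⧸ H)} (ξ : VectG ρ F M) : Type u := TensorTotal F V ξ.Fib

end VectG

variable (X) in
/-- An object of the disjoint union of the `Vect_G(M, ρ)` over all principal `G₀`-bundles `M` over
`X`. -/
structure VectGUnion (ρ : Representation ℂ H V) (F : Type u) [NormedAddCommGroup F]
    [InnerProductSpace ℂ F] : Type (u + 1) where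
  base : PrincipalBundle X (G ⧸ H)
  bundle : VectG ρ F base

namespace VectGUnion

variable {ρ : Representation ℂ H V} {F : Type u} [NormedAddCommGroup F] [InnerProductSpace ℂ F]

/-- Equivalences of `G`-vector bundles: `G`-equivariant homeomorphisms of the total spaces that are
linear isomorphisms on the fibres and cover a morphism of principal `G₀`-bundles over `X`. -/
@[ext]
structure Hom (A B : VectGUnion X ρ F) : Type u where
  base : A.base ⟶ B.base
  total : A.bundle.Total ≃ₜ B.bundle.Total
  linear : ∀ m : A.base.Total,
    ∃ T : (A.bundle.Fib m ⊗[ℂ] V) ≃ₗ[ℂ] (B.bundle.Fib (base.toFun m) ⊗[ℂ] V),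
      ∀ w, total ⟨m, w⟩ = ⟨base.toFun m, T w⟩
  map_smul : ∀ (g : G) (t : A.bundle.Total), total (g • t) = g • total t

/-- The disjoint union of the categories `Vect_G(M, ρ)` over all principal `G₀`-bundles `M → X`,
isomorphic `M` being identified: morphisms cover isomorphisms of the bundles `M` over `X`, so
objects over non-isomorphic `M` are not connected by a morphism. -/
noncomputable instance : LargeCategory (VectGUnion X ρ F) where
  Hom := Hom
  id A := ⟨𝟙 A.base, Homeomorph.refl _, fun _ => ⟨LinearEquiv.refl ℂ _, fun _ => rfl⟩,
    fun _ _ => rfl⟩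
  comp {A B C} f g := ⟨f.base ≫ g.base, f.total.trans g.total, fun m => by
      obtain ⟨S, hS⟩ := f.linear m
      obtain ⟨T, hT⟩ := g.linear (f.base.toFun m)
      refine ⟨S.trans T, fun w => ?_⟩
      rw [Homeomorph.trans_apply, hS, hT]
      rfl,
    fun a t => by
      rw [Homeomorph.trans_apply, f.map_smul, g.map_smul]
      rfl⟩

/-- The projection `ξ → M → X`. -/
def projX (A : VectGUnion X ρ F) (t : A.bundle.Total) : X := A.base.proj t.proj

/-- The pair `M → X`, `ξ → M` is obtained from the `Aut_G(G₀ × (F ⊗ V))`-valued cocycle `(U, Ψ)`: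
`M` is the principal `G₀`-bundle with cocycle `pr ∘ Ψ` (realized by sections `s i`), and `ξ` is
glued from the spaces `U i × (G₀ × (F ⊗ V))` along `Ψ`, through `G`-equivariant homeomorphisms `ψ i`
onto the parts of `ξ` over `U i` that map `{x} × {q} × (F ⊗ V)` linearly onto the fibre of `ξ` over
the point `q • s i x` of `M`. -/
def IsGluedFrom (c : RightModuleMap H) (A : VectGUnion X ρ F) {ι : Type u} (U : ι → Set X)
    (Ψ : ι → ι → X → CanonicalModel.Aut ρ F c) : Prop :=
  ∃ (s : ι → X → A.base.Total)
    (ψ : ∀ i, (U i × CanonicalModel ρ F c) ≃ₜ {t : A.bundle.Total // A.projX t ∈ U i}),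
    (∀ i, ContinuousOn (s i) (U i)) ∧
    (∀ i, ∀ x ∈ U i, A.base.proj (s i x) = x) ∧
    (∀ i j, ∀ x ∈ U i ∩ U j, s j x = CanonicalModel.pr ρ F c (Ψ i j x) • s i x) ∧
    (∀ i (x : U i) (q : G ⧸ H),
      ∃ T : (F ⊗[ℂ] V) ≃ₗ[ℂ] (A.bundle.Fib (q • s i x) ⊗[ℂ] V),
        ∀ w, (ψ i (x, ⟨q, w⟩) : A.bundle.Total) = ⟨q • s i x, T w⟩) ∧
    (∀ i (x : U i) (g : G) (y : CanonicalModel ρ F c),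
      (ψ i (x, g • y) : A.bundle.Total) = g • (ψ i (x, y) : A.bundle.Total)) ∧
    ∀ i j (x : X) (hi : x ∈ U i) (hj : x ∈ U j) (y : CanonicalModel ρ F c),
      (ψ j (⟨x, hj⟩, (Ψ i j x : Equiv.Perm (CanonicalModel ρ F c)) y) : A.bundle.Total) =
        ψ i (⟨x, hi⟩, y)

end VectGUnion

end QuasiFree

/-!
The equivalence is inverse to the frame functor. A frame of a `G`-vector bundle `ξ → M → X` over a
point of `X` is a `G`-equivariant map of the canonical model `G₀ × (F ⊗ V)` to `ξ` that is a linear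
isomorphism from each fibre onto a fibre of `ξ`, the base points running through one orbit of `G₀`
in `M`. The group `Aut_G(G₀ × (F ⊗ V))` acts simply transitively on the frames over a point, by
`T • p = p ∘ T⁻¹`. With the topology of pointwise convergence the frames form a principal bundle
over `X`. The reason is that `ξ` is locally, over `X`, `G`-equivariantly the product with the
canonical model (`VectGUnion.exists_local_frame`): a local section of `M` and a trivialization of
`ξ₀` along it parametrize `ξ` over the section, and the action of `G` carries this to the whole
orbit. The topology of the automorphism group causes no difficulty: its elements are families of
operators on finite-dimensional spaces indexed by a discrete space, so that inversion and
evaluation are continuous.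

The frame functor is faithful because the frames cover `ξ`, and full because a morphism `φ` of frame
bundles induces the map `p y ↦ φ(p) y`. Gluing `ξ` from the canonical models along a cocycle `Ψ`
means precisely that the frame bundle has local sections with transition functions `Ψ`
(`VectGUnion.isGluedFrom_iff_hasCocycle`). As principal bundles with the same transition functions
are isomorphic, this gives the description of the correspondence by cocycles; the base points of the
frames transform by `pr ∘ Ψ`.

Essential surjectivity uses the hypotheses on `ρ`. A cocycle `Ψ` first determines a principal
`G₀`-bundle `M` with transition functions `pr ∘ Ψ`, and it remains to find a bundle `ξ₀` on `M` for
which `ξ = ξ₀ ⊗ V` with `H` acting by `id ⊗ ρ`. On the fibre of the canonical model over `[g]` the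
group `H` acts by a conjugate of `ρ`, which is equivalent to `ρ`; so there are coordinates on the
fibres in which `H` acts by `id ⊗ ρ` everywhere (`CanonicalModel.FibreSplitting`). Automorphisms
commute with `H`, hence by Schur's lemma they have the form `b ⊗ id` in these coordinates, and the
operators `b` depend continuously on the automorphism, since they are obtained from it by a partial
contraction. The operators `b` for the automorphisms `Ψ i j x` are the transition functions of `ξ₀`,
and the action of `G` on the canonical model, being compatible with automorphisms, descends to the
glued bundle.

For the fixed vectors, the sum of the operators `ρ h` over `H` maps `V` to the invariants of `ρ`,
which vanish if `ρ` is irreducible and non-trivial. On a vector of `ξ` fixed by `H` the same sum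
acts as multiplication by the order of `H`, so the vector is zero.
-/

set_option linter.unusedSectionVars false

/-! ### The automorphism group of the canonical model -/

namespace CanonicalModel

variable {G : Type u} [Group G] {H : Subgroup G}
  {V : Type u} [NormedAddCommGroup V] [InnerProductSpace ℂ V]
  {ρ : Representation ℂ H V} {F : Type u} [NormedAddCommGroup F] [InnerProductSpace ℂ F]
  {c : RightModuleMap H}

theorem phi_mul (a b : G) (q : G ⧸ H) (w : F ⊗[ℂ] V) :
    phi ρ F c (a * b) q w = phi ρ F c a (b • q) (phi ρ F c b q w) :=
  congrArg CanonicalModel.vec (mul_smul a b (⟨q, w⟩ : CanonicalModel ρ F c))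

theorem phi_one (q : G ⧸ H) (w : F ⊗[ℂ] V) : phi ρ F c 1 q w = w :=
  congrArg CanonicalModel.vec (one_smul G (⟨q, w⟩ : CanonicalModel ρ F c))

variable (ρ F c) in
/-- The operators `φ(g, q)` are invertible. -/
noncomputable def phiEquiv (g : G) (q : G ⧸ H) :
    (F ⊗[ℂ] V) ≃ₗ[ℂ] (F ⊗[ℂ] V) :=
  LinearEquiv.ofLinearMap (phi ρ F c g q) (phi ρ F c g⁻¹ (g • q))
    (by
      refine LinearMap.ext fun w => ?_
      simp only [LinearMap.comp_apply, LinearMap.id_apply]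
      have := phi_mul (ρ := ρ) (F := F) (c := c) g g⁻¹ (g • q) w
      rw [inv_smul_smul, mul_inv_cancel, phi_one] at this
      exact this.symm)
    (by
      refine LinearMap.ext fun w => ?_
      simp only [LinearMap.comp_apply, LinearMap.id_apply]
      rw [← phi_mul, inv_mul_cancel, phi_one])

variable [H.Normal] [FiniteDimensional ℂ V] [FiniteDimensional ℂ F]

theorem aut_base (T : Aut ρ F c) (q : G ⧸ H) (w : F ⊗[ℂ] V) :
    (T.1 ⟨q, w⟩).base = q * (pr ρ F c T)⁻¹ := by
  rw [aut_apply_base]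
  exact congrArg (q * ·) (inv_inv _).symm

/-- The linear operator by which an automorphism maps the fibre over `q`. -/
noncomputable def fiberMap (T : Aut ρ F c) (q : G ⧸ H) : (F ⊗[ℂ] V) →L[ℂ] (F ⊗[ℂ] V) :=
  LinearMap.toContinuousLinearMap
    { toFun := fun w => (T.1 ⟨q, w⟩).vec
      map_add' := fun v w => by
        obtain ⟨a, A, hA⟩ := T.2.1
        simp only [hA, map_add]
      map_smul' := fun r w => by
        obtain ⟨a, A, hA⟩ := T.2.1
        simp only [hA, map_smul, RingHom.id_apply] }

theorem fiberMap_apply (T : Aut ρ F c) (q : G ⧸ H) (w : F ⊗[ℂ] V) :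
    fiberMap T q w = (T.1 ⟨q, w⟩).vec := rfl

theorem aut_apply (T : Aut ρ F c) (q : G ⧸ H) (w : F ⊗[ℂ] V) :
    T.1 ⟨q, w⟩ = ⟨q * (pr ρ F c T)⁻¹, fiberMap T q w⟩ := by
  ext1
  · exact aut_base T q w
  · rfl

theorem fiberMap_one (q : G ⧸ H) : fiberMap (1 : Aut ρ F c) q = 1 := rfl

theorem fiberMap_mul (S T : Aut ρ F c) (q : G ⧸ H) :
    fiberMap (S * T) q = fiberMap S (q * (pr ρ F c T)⁻¹) * fiberMap T q := by
  ext1 w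
  change _ = fiberMap S (q * (pr ρ F c T)⁻¹) (fiberMap T q w)
  rw [fiberMap_apply S, ← aut_apply]
  rfl

/-- Equivariance of an automorphism, in terms of its fibre maps. -/
theorem fiberMap_phi (T : Aut ρ F c) (g : G) (q : G ⧸ H) (w : F ⊗[ℂ] V) :
    fiberMap T (g • q) (phi ρ F c g q w) =
      phi ρ F c g (q * (pr ρ F c T)⁻¹) (fiberMap T q w) := by
  have h := congrArg CanonicalModel.vec (T.2.2 g ⟨q, w⟩)
  rw [aut_apply T q w] at h
  exact h

section Topology

variable [TopologicalSpace G]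

theorem continuous_mk (q : G ⧸ H) : Continuous (fun w => (⟨q, w⟩ : CanonicalModel ρ F c)) :=
  continuous_induced_rng.2 (by fun_prop)

theorem continuous_base_vec :
    Continuous (fun y : CanonicalModel ρ F c => ((y.base, y.vec) : (G ⧸ H) × (F ⊗[ℂ] V))) :=
  continuous_induced_dom

theorem continuous_base : Continuous (CanonicalModel.base : CanonicalModel ρ F c → G ⧸ H) :=
  continuous_fst.comp continuous_base_vec

theorem continuous_vec : Continuous (CanonicalModel.vec : CanonicalModel ρ F c → F ⊗[ℂ] V) :=
  continuous_snd.comp continuous_base_vec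

theorem continuous_rng {Z : Type*} [TopologicalSpace Z] {f : Z → CanonicalModel ρ F c}
    (h₁ : Continuous (fun z => (f z).base)) (h₂ : Continuous (fun z => (f z).vec)) :
    Continuous f :=
  continuous_induced_rng.2 (h₁.prodMk h₂)

theorem continuous_aut_apply (y : CanonicalModel ρ F c) :
    Continuous (fun T : Aut ρ F c => T.1 y) :=
  (continuous_apply y).comp (continuous_induced_dom (f := fun (T : Aut ρ F c) y => T.1 y))

theorem continuous_aut_rng {Z : Type*} [TopologicalSpace Z] {f : Z → Aut ρ F c}
    (h : ∀ y, Continuous (fun z => (f z).1 y)) : Continuous f :=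
  continuous_induced_rng.2 (continuous_pi h)

variable [DiscreteTopology G]

instance discreteTopology_quotient : DiscreteTopology (G ⧸ H) :=
  QuotientGroup.discreteTopology (isOpen_discrete _)

theorem continuous_pr : Continuous (pr ρ F c : Aut ρ F c → G ⧸ H) :=
  (continuous_of_discreteTopology (f := fun q : G ⧸ H => q⁻¹)).comp
    (continuous_base.comp (continuous_aut_apply ⟨1, 0⟩))

theorem continuous_fiberMap :
    Continuous (fun p : Aut ρ F c × (G ⧸ H) => fiberMap p.1 p.2) :=
  continuous_prod_of_discrete_right.2 fun q => continuous_clm_apply.2 fun w =>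
    continuous_vec.comp (continuous_aut_apply ⟨q, w⟩)

/-- Evaluation of automorphisms is jointly continuous, since the fibres have finite dimension. -/
theorem continuous_eval :
    Continuous (fun p : Aut ρ F c × CanonicalModel ρ F c => p.1.1 p.2) := by
  have hb : Continuous (fun p : Aut ρ F c × CanonicalModel ρ F c => p.2.base) :=
    continuous_base.comp continuous_snd
  have hp : Continuous (fun p : Aut ρ F c × CanonicalModel ρ F c => pr ρ F c p.1) :=
    continuous_pr.comp continuous_fst
  refine continuous_rng ?_ ?_
  · change Continuous (fun p : Aut ρ F c × CanonicalModel ρ F c =>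
      (p.1.1 ⟨p.2.base, p.2.vec⟩).base)
    simp only [aut_base]
    exact (continuous_of_discreteTopology (f := fun x : (G ⧸ H) × (G ⧸ H) => x.1 * x.2⁻¹)).comp
      (hb.prodMk hp)
  · exact (continuous_fiberMap.comp (continuous_fst.prodMk hb)).clm_apply
      (continuous_vec.comp continuous_snd)

/-- Expressing the inverse through `Ring.inverse` makes the continuity of inversion in a Banach
algebra available. -/
theorem fiberMap_inv (T : Aut ρ F c) (q : G ⧸ H) :
    fiberMap T⁻¹ q = Ring.inverse (fiberMap T (q * pr ρ F c T)) := by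
  have h1 := fiberMap_mul T T⁻¹ q
  have h2 := fiberMap_mul T⁻¹ T (q * pr ρ F c T)
  rw [mul_inv_cancel, fiberMap_one, map_inv, inv_inv] at h1
  rw [inv_mul_cancel, fiberMap_one, mul_inv_cancel_right] at h2
  exact (Ring.inverse_unit ⟨_, _, h1.symm, h2.symm⟩).symm

/-- Inversion is continuous for the pointwise topology because it is so for operators on the
finite-dimensional fibres. -/
instance isTopologicalGroup_aut : IsTopologicalGroup (Aut ρ F c) where
  continuous_mul := continuous_aut_rng fun y =>
    continuous_eval.comp
      (continuous_fst.prodMk ((continuous_aut_apply y).comp continuous_snd))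
  continuous_inv := by
    have : CompleteSpace (F ⊗[ℂ] V) := FiniteDimensional.complete ℂ _
    refine continuous_aut_rng fun y => continuous_rng ?_ ?_
    · change Continuous (fun T : Aut ρ F c => (T⁻¹.1 ⟨y.base, y.vec⟩).base)
      simp only [aut_base, map_inv, inv_inv]
      exact (continuous_of_discreteTopology (f := fun x : G ⧸ H => y.base * x)).comp continuous_pr
    · have h : Continuous (fun T : Aut ρ F c => fiberMap T (y.base * pr ρ F c T)) :=
        continuous_fiberMap.comp (continuous_id.prodMk
          ((continuous_of_discreteTopology (f := fun x : G ⧸ H => y.base * x)).comp continuous_pr))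
      have h' : Continuous (fun T : Aut ρ F c =>
          Ring.inverse (fiberMap T (y.base * pr ρ F c T))) := by
        refine continuous_iff_continuousAt.2 fun T => ?_
        have hu : IsUnit (fiberMap T (y.base * pr ρ F c T)) := by
          have h1 := fiberMap_mul T T⁻¹ y.base
          have h2 := fiberMap_mul T⁻¹ T (y.base * pr ρ F c T)
          rw [mul_inv_cancel, fiberMap_one, map_inv, inv_inv] at h1
          rw [inv_mul_cancel, fiberMap_one, mul_inv_cancel_right] at h2
          exact ⟨⟨_, _, h1.symm, h2.symm⟩, rfl⟩
        obtain ⟨v, hv⟩ := hu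
        have := NormedRing.inverse_continuousAt (R := (F ⊗[ℂ] V) →L[ℂ] (F ⊗[ℂ] V)) v
        rw [hv] at this
        exact ContinuousAt.comp (f := fun T : Aut ρ F c => fiberMap T (y.base * pr ρ F c T))
          this h.continuousAt
      simp only [← fiberMap_inv] at h'
      exact h'.clm_apply continuous_const

end Topology

end CanonicalModel

/-! ### Charts of the bundle `ξ₀ ⊗ V` -/

namespace TensorBundle

variable {F V : Type u} [NormedAddCommGroup F] [InnerProductSpace ℂ F] [FiniteDimensional ℂ F]
  [NormedAddCommGroup V] [InnerProductSpace ℂ V] [FiniteDimensional ℂ V]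

/-- The operator `A ↦ A ⊗ id` on endomorphisms, as a linear map. -/
noncomputable def rTensorₗ : (F →L[ℂ] F) →ₗ[ℂ] ((F ⊗[ℂ] V) →L[ℂ] (F ⊗[ℂ] V)) where
  toFun A := LinearMap.toContinuousLinearMap (LinearMap.rTensor V (A : F →ₗ[ℂ] F))
  map_add' A B := by
    ext1 w
    exact LinearMap.congr_fun (LinearMap.rTensor_add V (A : F →ₗ[ℂ] F) B) w
  map_smul' r A := by
    ext1 w
    exact LinearMap.congr_fun (LinearMap.rTensor_smul V r (A : F →ₗ[ℂ] F)) w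

theorem continuous_rTensorₗ :
    Continuous (rTensorₗ : (F →L[ℂ] F) →ₗ[ℂ] ((F ⊗[ℂ] V) →L[ℂ] (F ⊗[ℂ] V))) :=
  LinearMap.continuous_of_finiteDimensional _

variable {M : Type u} [TopologicalSpace M] {E : M → Type u}
    [∀ m, AddCommGroup (E m)] [∀ m, Module ℂ (E m)] [∀ m, TopologicalSpace (E m)]
    [TopologicalSpace (Bundle.TotalSpace F E)] [FiberBundle F E] [VectorBundle ℂ F E]
  (e : Bundle.Trivialization F (Bundle.TotalSpace.proj : Bundle.TotalSpace F E → M))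
  [MemTrivializationAtlas e]
  (e' : Bundle.Trivialization F (Bundle.TotalSpace.proj : Bundle.TotalSpace F E → M))
  [MemTrivializationAtlas e']

/-- The chart of `ξ₀ ⊗ V` given by a local trivialization of `ξ₀`. -/
noncomputable def chart (z : e.baseSet × (F ⊗[ℂ] V)) : TensorTotal F V E :=
  ⟨z.1, LinearMap.rTensor V (e.symmₗ ℂ (z.1 : M)) z.2⟩

/-- The linear isomorphism from the model fibre to the fibre of `ξ₀ ⊗ V` over `m`. -/
noncomputable def chartFib (m : e.baseSet) : (F ⊗[ℂ] V) ≃ₗ[ℂ] (E m ⊗[ℂ] V) :=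
  LinearEquiv.rTensor V (e.linearEquivAt ℂ m m.2).symm

theorem chart_eq (m : e.baseSet) (w : F ⊗[ℂ] V) :
    chart e (m, w) = ⟨m, chartFib e m w⟩ := by
  have : e.symmₗ ℂ (m : M) = ((e.linearEquivAt ℂ m m.2).symm : F →ₗ[ℂ] E m) := by
    ext1 v
    rw [e.symmₗ_apply m.2]
    exact (e.linearEquivAt_symm_apply m m.2 v).symm
  rw [chart, this]
  rfl

theorem chart_injective : Function.Injective (chart (V := V) e) := by
  rintro ⟨⟨m, hm⟩, w⟩ ⟨⟨m', hm'⟩, w'⟩ h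
  rw [chart_eq, chart_eq] at h
  obtain rfl : m = m' := congrArg Bundle.TotalSpace.proj h
  have h2 := (chartFib e ⟨m, hm⟩).injective (eq_of_heq (Bundle.TotalSpace.mk.inj h).2)
  rw [h2]

theorem continuous_chart : Continuous (chart (V := V) e) :=
  continuous_iff_coinduced_le.2 (le_iSup₂_of_le e inferInstance le_rfl)

/-- A map out of `ξ₀ ⊗ V` is continuous as soon as it is continuous in all charts. -/
theorem continuous_of_chart {Z : Type*} [TopologicalSpace Z] {f : TensorTotal F V E → Z}
    (h : ∀ (e : Bundle.Trivialization F (Bundle.TotalSpace.proj : Bundle.TotalSpace F E → M))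
      [MemTrivializationAtlas e], Continuous (f ∘ chart e)) : Continuous f :=
  continuous_iSup_dom.2 fun e => continuous_iSup_dom.2 fun _ => continuous_coinduced_dom.2 (h e)

theorem isOpen_iff_chart {S : Set (TensorTotal F V E)} :
    IsOpen S ↔
    ∀ (e : Bundle.Trivialization F (Bundle.TotalSpace.proj : Bundle.TotalSpace F E → M))
      [MemTrivializationAtlas e], IsOpen (chart e ⁻¹' S) := by
  constructor
  · intro h e _
    exact h.preimage (continuous_chart e)
  · intro h
    have := continuous_of_chart (V := V) (F := F) (E := E) (f := fun t => (t ∈ S : Prop))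
      (fun e _ => continuous_Prop.2 (h e))
    exact continuous_Prop.1 this

theorem continuous_proj : Continuous (Bundle.TotalSpace.proj : TensorTotal F V E → M) :=
  continuous_of_chart fun _ => continuous_subtype_val.comp continuous_fst

/-- On overlaps, charts of `ξ₀ ⊗ V` differ by the transition functions of `ξ₀`, tensored with
`id`. -/
theorem chart_change (m : M) (hm : m ∈ e.baseSet) (hm' : m ∈ e'.baseSet) (w : F ⊗[ℂ] V) :
    chart e (⟨m, hm⟩, w) =
      chart e' (⟨m, hm'⟩, rTensorₗ (e.coordChangeL ℂ e' m : F →L[ℂ] F) w) := by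
  refine Bundle.TotalSpace.mk_inj.2 ?_
  have : e.symmₗ ℂ m = e'.symmₗ ℂ m ∘ₗ ((e.coordChangeL ℂ e' m : F →L[ℂ] F) : F →ₗ[ℂ] F) := by
    ext1 v
    rw [LinearMap.comp_apply, e.symmₗ_apply hm, e'.symmₗ_apply hm']
    change _ = e'.symm m (e.coordChangeL ℂ e' m v)
    rw [e.coordChangeL_apply e' ⟨hm, hm'⟩, e'.symm_apply_apply_mk hm']
  change LinearMap.rTensor V (e.symmₗ ℂ m) w = LinearMap.rTensor V (e'.symmₗ ℂ m)
    (LinearMap.rTensor V ((e.coordChangeL ℂ e' m : F →L[ℂ] F) : F →ₗ[ℂ] F) w)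
  rw [← LinearMap.comp_apply, ← LinearMap.rTensor_comp, this]

/-- The topology glued from the charts has them as open embeddings, since the chart changes are
homeomorphisms between open sets. -/
theorem isOpenEmbedding_chart : IsOpenEmbedding (chart (V := V) e) := by
  refine .of_continuous_injective_isOpenMap (continuous_chart e) (chart_injective e) ?_
  intro O hO
  refine isOpen_iff_chart.2 fun e' _ => ?_
  -- on the overlap, the chart change is a continuous map `k`
  let B : Set (e'.baseSet × (F ⊗[ℂ] V)) := {z | (z.1 : M) ∈ e.baseSet}
  have hB : IsOpen B := e.open_baseSet.preimage (continuous_subtype_val.comp continuous_fst)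
  let k : B → e.baseSet × (F ⊗[ℂ] V) := fun z =>
    (⟨z.1.1, z.2⟩, rTensorₗ (e'.coordChangeL ℂ e z.1.1 : F →L[ℂ] F) z.1.2)
  have hk : Continuous k := by
    refine Continuous.prodMk ?_ ?_
    · exact Continuous.subtype_mk (by fun_prop) _
    · refine Continuous.clm_apply ?_ (by fun_prop)
      refine continuous_rTensorₗ.comp ?_
      have h1 := continuousOn_coordChange ℂ e' e
      refine h1.comp_continuous (f := fun z : B => (z.1.1 : M)) (by fun_prop) ?_
      exact fun z => ⟨z.1.1.2, z.2⟩
  have hpre : chart e' ⁻¹' (chart e '' O) = Subtype.val '' (k ⁻¹' O) := by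
    ext ⟨⟨m, hm⟩, w⟩
    constructor
    · rintro ⟨⟨⟨n, hn⟩, v⟩, hO, h⟩
      obtain rfl : n = m := congrArg Bundle.TotalSpace.proj h
      refine ⟨⟨(⟨n, hm⟩, w), hn⟩, ?_, rfl⟩
      have h2 : chart e (⟨n, hn⟩, v) = chart e (k ⟨(⟨n, hm⟩, w), hn⟩) :=
        h.trans (chart_change e' e n hm hn w)
      change k _ ∈ O
      rw [← chart_injective e h2]
      exact hO
    · rintro ⟨⟨⟨⟨n, hn⟩, v⟩, hz⟩, hO, h⟩
      rw [← h]
      exact ⟨_, hO, (chart_change e' e n hn hz v).symm⟩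
  rw [hpre]
  exact hB.isOpenMap_subtype_val _ (hO.preimage hk)

end TensorBundle

/-! ### Principal bundles and transition functions -/

namespace PrincipalBundle

/-- The continuity of the action in a principal bundle follows from its local triviality. -/
theorem continuous_smul_of_locally_trivial {X L Y : Type u} [TopologicalSpace X]
    [TopologicalSpace L] [Group L] [IsTopologicalGroup L] [TopologicalSpace Y] [MulAction L Y]
    {π : Y → X} (hπ : Continuous π) (hsmul : ∀ (l : L) (p : Y), π (l • p) = π p)
    (htriv : ∀ x : X, ∃ e : Bundle.Trivialization L π, x ∈ e.baseSet ∧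
      ∀ (l : L) (p : Y), π p ∈ e.baseSet → (e (l • p)).2 = l * (e p).2) :
    ContinuousSMul L Y where
  continuous_smul := by
    refine continuous_iff_continuousAt.2 fun ⟨l₀, p₀⟩ => ?_
    obtain ⟨e, he, hmul⟩ := htriv (π p₀)
    have hopen : IsOpen {z : L × Y | π z.2 ∈ e.baseSet} :=
      e.open_baseSet.preimage (hπ.comp continuous_snd)
    refine ContinuousOn.continuousAt (s := {z : L × Y | π z.2 ∈ e.baseSet}) ?_
      (hopen.mem_nhds he)
    have h1 : ContinuousOn (fun z : L × Y => e z.2) {z : L × Y | π z.2 ∈ e.baseSet} :=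
      e.continuousOn_toFun.comp (s := {z : L × Y | π z.2 ∈ e.baseSet}) continuousOn_snd
      fun z hz => e.mem_source.2 hz
    have h2 : ContinuousOn (fun z : L × Y => (π z.2, z.1 * (e z.2).2))
        {z : L × Y | π z.2 ∈ e.baseSet} :=
      (hπ.comp continuous_snd).continuousOn.prodMk
        (continuousOn_fst.mul (continuous_snd.comp_continuousOn h1))
    have h3 : ContinuousOn
        (fun z : L × Y => e.toOpenPartialHomeomorph.symm (π z.2, z.1 * (e z.2).2))
        {z : L × Y | π z.2 ∈ e.baseSet} :=
      e.toOpenPartialHomeomorph.continuousOn_symm.comp h2 fun z hz => e.mem_target.2 hz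
    refine h3.congr fun z hz => ?_
    have hz' : z.1 • z.2 ∈ e.source := e.mem_source.2 (by rw [hsmul]; exact hz)
    have : e (z.1 • z.2) = (π z.2, z.1 * (e z.2).2) := by
      rw [← e.mk_proj_snd hz', hsmul, hmul _ _ hz]
    change _ = e.toOpenPartialHomeomorph.symm (π z.2, z.1 * (e z.2).2)
    rw [← this]
    exact (e.left_inv hz').symm

variable {X L : Type u} [TopologicalSpace X] [TopologicalSpace L] [Group L]

theorem exists_smul_eq (P : PrincipalBundle X L) {p q : P.Total} (h : P.proj p = P.proj q) :
    ∃ l : L, q = l • p := by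
  obtain ⟨e, he, hmul⟩ := P.locally_trivial (P.proj p)
  have hq : P.proj q ∈ e.baseSet := h ▸ he
  refine ⟨(e q).2 * (e p).2⁻¹, e.injOn (e.mem_source.2 hq)
    (e.mem_source.2 (by rw [P.proj_smul]; exact he)) ?_⟩
  refine Prod.ext ?_ ?_
  · change (e q).1 = (e (_ • p)).1
    rw [e.coe_fst' hq, e.coe_fst' (by rw [P.proj_smul]; exact he), P.proj_smul, h]
  · change (e q).2 = (e (_ • p)).2
    rw [hmul _ _ he, inv_mul_cancel_right]

theorem smul_left_cancel' (P : PrincipalBundle X L) {p : P.Total} {l l' : L}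
    (h : l • p = l' • p) : l = l' := by
  obtain ⟨e, he, hmul⟩ := P.locally_trivial (P.proj p)
  have := congrArg (fun z => (e z).2) h
  simp only [hmul _ _ he] at this
  exact mul_right_cancel this

/-- Two sections that differ by a function with values in `L` determine it continuously. -/
theorem continuousOn_of_smul_eq [IsTopologicalGroup L] (P : PrincipalBundle X L) {Z : Type*}
    [TopologicalSpace Z] {S : Set Z} {s t : Z → P.Total} {l : Z → L}
    (hs : ContinuousOn s S) (ht : ContinuousOn t S) (h : ∀ z ∈ S, t z = l z • s z) :
    ContinuousOn l S := by
  intro z₀ hz₀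
  obtain ⟨e, he, hmul⟩ := P.locally_trivial (P.proj (s z₀))
  have hs' : ContinuousWithinAt (fun z => (e (s z)).2) S z₀ :=
    (continuous_snd.continuousAt.comp
      (e.continuousAt (e.mem_source.2 he))).comp_continuousWithinAt (hs z₀ hz₀)
  have ht' : ContinuousWithinAt (fun z => (e (t z)).2) S z₀ :=
    (continuous_snd.continuousAt.comp
      (e.continuousAt (e.mem_source.2 (by rw [h z₀ hz₀, P.proj_smul]; exact he))
        )).comp_continuousWithinAt (ht z₀ hz₀)
  have hev : ∀ᶠ z in 𝓝[S] z₀, P.proj (s z) ∈ e.baseSet ∧ z ∈ S :=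
    ((P.continuous_proj.continuousAt.comp_continuousWithinAt (hs z₀ hz₀)).eventually_mem
      (e.open_baseSet.mem_nhds he)).and self_mem_nhdsWithin
  refine (ht'.mul hs'.inv).congr_of_eventuallyEq ?_ ?_
  · filter_upwards [hev] with z hz
    change l z = (e (t z)).2 * (e (s z)).2⁻¹
    rw [h z hz.2, hmul _ _ hz.1, mul_inv_cancel_right]
  · change l z₀ = (e (t z₀)).2 * (e (s z₀)).2⁻¹
    rw [h z₀ hz₀, hmul _ _ he, mul_inv_cancel_right]

theorem proj_surjective (P : PrincipalBundle X L) : Function.Surjective P.proj := by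
  intro x
  obtain ⟨e, he, -⟩ := P.locally_trivial x
  exact ⟨e.toOpenPartialHomeomorph.symm (x, 1), e.proj_symm_apply' he⟩

theorem exists_hasCocycle (P : PrincipalBundle X L) :
    ∃ (ι : Type u) (U : ι → Set X) (Ψ : ι → ι → X → L), P.HasCocycle U Ψ := by
  choose e he hmul using P.locally_trivial
  have : ∀ i j x, ∃ l : L, x ∈ (e i).baseSet ∩ (e j).baseSet →
      (e j).toOpenPartialHomeomorph.symm (x, 1) =
        l • (e i).toOpenPartialHomeomorph.symm (x, 1) := by
    intro i j x
    by_cases hx : x ∈ (e i).baseSet ∩ (e j).baseSet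
    · have h1 : P.proj ((e i).toOpenPartialHomeomorph.symm (x, 1)) = x :=
        (e i).proj_symm_apply' hx.1
      have h2 : P.proj ((e j).toOpenPartialHomeomorph.symm (x, 1)) = x :=
        (e j).proj_symm_apply' hx.2
      obtain ⟨l, hl⟩ := P.exists_smul_eq (h1.trans h2.symm)
      exact ⟨l, fun _ => hl⟩
    · exact ⟨1, fun h => (hx h).elim⟩
  choose Ψ hΨ using this
  refine ⟨X, fun i => (e i).baseSet, Ψ, fun i => (e i).open_baseSet, ?_,
    fun i x => (e i).toOpenPartialHomeomorph.symm (x, 1), fun i => ?_, fun i x hx => ?_, hΨ⟩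
  · exact Set.eq_univ_of_forall fun x => Set.mem_iUnion.2 ⟨x, he x⟩
  · exact (e i).continuousOn_symm_prodMk_left
  · exact (e i).proj_symm_apply' hx

/-- A morphism carries local sections to local sections with the same transition functions. -/
theorem HasCocycle.of_hom {P Q : PrincipalBundle X L} (f : P ⟶ Q) {ι : Type u} {U : ι → Set X}
    {Ψ : ι → ι → X → L} (h : P.HasCocycle U Ψ) : Q.HasCocycle U Ψ := by
  obtain ⟨hU, hc, s, hs, hp, ht⟩ := h
  refine ⟨hU, hc, fun i x => f.toFun (s i x),
    fun i => f.continuous_toFun.comp_continuousOn (hs i), fun i x hx => ?_, fun i j x hx => ?_⟩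
  · rw [f.proj_toFun, hp i x hx]
  · change f.toFun (s j x) = _ • f.toFun (s i x)
    rw [ht i j x hx, f.map_smul]

/-- Sections of two principal bundles with the same transition functions are matched by a
morphism. -/
theorem exists_hom_of_sections [IsTopologicalGroup L] {P Q : PrincipalBundle X L} {ι : Type u}
    {U : ι → Set X} {Ψ : ι → ι → X → L} (hU : ∀ i, IsOpen (U i)) (hc : (⋃ i, U i) = Set.univ)
    {s : ι → X → P.Total} (hs : ∀ i, ContinuousOn (s i) (U i))
    (hsp : ∀ i, ∀ x ∈ U i, P.proj (s i x) = x)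
    (hsΨ : ∀ i j, ∀ x ∈ U i ∩ U j, s j x = Ψ i j x • s i x)
    {t : ι → X → Q.Total} (ht : ∀ i, ContinuousOn (t i) (U i))
    (htp : ∀ i, ∀ x ∈ U i, Q.proj (t i x) = x)
    (htΨ : ∀ i j, ∀ x ∈ U i ∩ U j, t j x = Ψ i j x • t i x) :
    ∃ f : P ⟶ Q, ∀ i, ∀ x ∈ U i, ∀ l : L, f.toFun (l • s i x) = l • t i x := by
  have hix : ∀ x, ∃ i, x ∈ U i := fun x => Set.mem_iUnion.1 (hc ▸ Set.mem_univ x)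
  choose k hk using hix
  have : ∀ i (p : P.Total), ∃ l : L, P.proj p ∈ U i → p = l • s i (P.proj p) := by
    intro i p
    by_cases hp : P.proj p ∈ U i
    · obtain ⟨l, hl⟩ := P.exists_smul_eq (hsp i _ hp)
      exact ⟨l, fun _ => hl⟩
    · exact ⟨1, fun h => (hp h).elim⟩
  choose l hl using this
  have hcont : ∀ i, ContinuousOn (l i) (P.proj ⁻¹' U i) := fun i =>
    P.continuousOn_of_smul_eq (s := fun p => s i (P.proj p)) (t := id)
      ((hs i).comp P.continuous_proj.continuousOn fun _ h => h) continuousOn_id (hl i)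
  let f : P.Total → Q.Total := fun p => l (k (P.proj p)) p • t (k (P.proj p)) (P.proj p)
  have hf : ∀ i (x : X), x ∈ U i → ∀ a : L, f (a • s i x) = a • t i x := by
    intro i x hx a
    have hpx : P.proj (a • s i x) = x := by rw [P.proj_smul, hsp i x hx]
    have h1 := hl (k (P.proj (a • s i x))) (a • s i x) (hk _)
    change l (k (P.proj (a • s i x))) (a • s i x) •
      t (k (P.proj (a • s i x))) (P.proj (a • s i x)) = _
    rw [hpx] at h1 ⊢
    have h2 := hsΨ i (k x) x ⟨hx, hk x⟩
    rw [h2, smul_smul] at h1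
    rw [htΨ i (k x) x ⟨hx, hk x⟩, smul_smul, ← P.smul_left_cancel' h1]
  refine ⟨⟨f, ?_, ?_, ?_⟩, hf⟩
  · refine continuous_iff_continuousAt.2 fun p => ?_
    have hp : P.proj ⁻¹' U (k (P.proj p)) ∈ 𝓝 p :=
      ((hU _).preimage P.continuous_proj).mem_nhds (hk _)
    refine ContinuousOn.continuousAt ?_ hp
    have h2 : ContinuousOn (fun p' => l (k (P.proj p)) p' • t (k (P.proj p)) (P.proj p'))
        (P.proj ⁻¹' U (k (P.proj p))) :=
      (hcont _).smul ((ht _).comp P.continuous_proj.continuousOn fun _ h => h)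
    refine h2.congr fun p' hp' => ?_
    conv_lhs => rw [hl _ p' hp']
    exact hf _ _ hp' _
  · intro a p
    conv_lhs => rw [hl _ p (hk _)]
    rw [smul_smul, hf _ _ (hk _), mul_smul]
  · intro p
    change Q.proj (_ • _) = _
    rw [Q.proj_smul, htp _ _ (hk _)]

/-- Principal bundles with the same transition functions are isomorphic. -/
theorem HasCocycle.nonempty_iso [IsTopologicalGroup L] {P Q : PrincipalBundle X L} {ι : Type u}
    {U : ι → Set X} {Ψ : ι → ι → X → L} (hP : P.HasCocycle U Ψ) (hQ : Q.HasCocycle U Ψ) :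
    Nonempty (P ≅ Q) := by
  obtain ⟨hU, hc, s, hs, hsp, hsΨ⟩ := hP
  obtain ⟨-, -, t, ht, htp, htΨ⟩ := hQ
  obtain ⟨f, hf⟩ := exists_hom_of_sections hU hc hs hsp hsΨ ht htp htΨ
  obtain ⟨g, hg⟩ := exists_hom_of_sections hU hc ht htp htΨ hs hsp hsΨ
  have hix : ∀ x, ∃ i, x ∈ U i := fun x => Set.mem_iUnion.1 (hc ▸ Set.mem_univ x)
  refine ⟨⟨f, g, Hom.ext (funext fun p => ?_), Hom.ext (funext fun p => ?_)⟩⟩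
  · obtain ⟨i, hi⟩ := hix (P.proj p)
    obtain ⟨l, hl⟩ := P.exists_smul_eq (hsp i _ hi)
    change g.toFun (f.toFun p) = p
    rw [hl, hf i _ hi, hg i _ hi]
  · obtain ⟨i, hi⟩ := hix (Q.proj p)
    obtain ⟨l, hl⟩ := Q.exists_smul_eq (htp i _ hi)
    change f.toFun (g.toFun p) = p
    rw [hl, hg i _ hi, hf i _ hi]

end PrincipalBundle

/-! ### Frames of a `G`-vector bundle -/

section

variable {X G : Type u} [TopologicalSpace X] [TopologicalSpace G] [Group G]
  {H : Subgroup G} [H.Normal]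
  {V : Type u} [NormedAddCommGroup V] [InnerProductSpace ℂ V]
  {ρ : Representation ℂ H V} {F : Type u} [NormedAddCommGroup F] [InnerProductSpace ℂ F]

namespace VectG

variable {M : PrincipalBundle X (G ⧸ H)} (ξ : VectG ρ F M)

theorem proj_smul (g : G) (t : ξ.Total) : (g • t).proj = (g : G ⧸ H) • t.proj := by
  obtain ⟨m, w⟩ := t
  obtain ⟨Φ, hΦ⟩ := ξ.smul_linear g m
  rw [hΦ]

/-- A map onto the fibre of `ξ` over `m` that is a linear isomorphism. -/
def IsFibreIso (m : M.Total) (f : F ⊗[ℂ] V → ξ.Total) : Prop :=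
  ∃ T : (F ⊗[ℂ] V) ≃ₗ[ℂ] (ξ.Fib m ⊗[ℂ] V), ∀ w, f w = ⟨m, T w⟩

variable {ξ}

theorem IsFibreIso.proj {m : M.Total} {f : F ⊗[ℂ] V → ξ.Total} (h : ξ.IsFibreIso m f)
    (w : F ⊗[ℂ] V) : (f w).proj = m := by
  obtain ⟨T, hT⟩ := h
  rw [hT]

theorem IsFibreIso.comp {m : M.Total} {f : F ⊗[ℂ] V → ξ.Total} (h : ξ.IsFibreIso m f)
    (A : (F ⊗[ℂ] V) ≃ₗ[ℂ] (F ⊗[ℂ] V)) : ξ.IsFibreIso m (fun w => f (A w)) := by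
  obtain ⟨T, hT⟩ := h
  exact ⟨A.trans T, fun w => hT _⟩

theorem IsFibreIso.injective {m : M.Total} {f : F ⊗[ℂ] V → ξ.Total} (h : ξ.IsFibreIso m f) :
    Function.Injective f := by
  obtain ⟨T, hT⟩ := h
  intro w w' hw
  rw [hT, hT] at hw
  exact T.injective (eq_of_heq (Bundle.TotalSpace.mk.inj hw).2)

theorem IsFibreIso.exists_eq {m : M.Total} {f : F ⊗[ℂ] V → ξ.Total} (h : ξ.IsFibreIso m f)
    {t : ξ.Total} (ht : t.proj = m) : ∃ w, f w = t := by
  obtain ⟨T, hT⟩ := h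
  obtain ⟨m', v⟩ := t
  obtain rfl : m' = m := ht
  exact ⟨T.symm v, by rw [hT, LinearEquiv.apply_symm_apply]⟩

/-- Two linear parametrizations of the same fibre differ by a linear automorphism. -/
theorem IsFibreIso.exists_comp_eq {m : M.Total} {f f' : F ⊗[ℂ] V → ξ.Total}
    (h : ξ.IsFibreIso m f) (h' : ξ.IsFibreIso m f') :
    ∃ A : (F ⊗[ℂ] V) ≃ₗ[ℂ] (F ⊗[ℂ] V), ∀ w, f (A w) = f' w := by
  obtain ⟨T, hT⟩ := h
  obtain ⟨T', hT'⟩ := h'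
  exact ⟨T'.trans T.symm, fun w => by simp [hT, hT']⟩

/-- The action of `G` is by linear isomorphisms of the fibres, `g⁻¹` providing the inverse. -/
theorem IsFibreIso.smul {m : M.Total} {f : F ⊗[ℂ] V → ξ.Total} (h : ξ.IsFibreIso m f) (g : G) :
    ξ.IsFibreIso ((g : G ⧸ H) • m) (fun w => g • f w) := by
  obtain ⟨T, hT⟩ := h
  obtain ⟨Φ, hΦ⟩ := ξ.smul_linear g m
  have hbij : Function.Bijective Φ := by
    constructor
    · intro v v' hv
      have h1 : g • (⟨m, v⟩ : ξ.Total) = g • (⟨m, v'⟩ : ξ.Total) := by rw [hΦ, hΦ, hv]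
      exact eq_of_heq (Bundle.TotalSpace.mk.inj (MulAction.injective g h1)).2
    · intro v
      let t : ξ.Total := g⁻¹ • (⟨(g : G ⧸ H) • m, v⟩ : ξ.Total)
      have ht : t.proj = m := by
        rw [proj_smul]
        change ((g : G ⧸ H)⁻¹) • (g : G ⧸ H) • m = m
        rw [inv_smul_smul]
      obtain ⟨v', hv'⟩ : ∃ v', t = ⟨m, v'⟩ := by
        rcases t with ⟨m', v'⟩
        obtain rfl : m' = m := ht
        exact ⟨v', rfl⟩
      have h2 : g • t = ⟨(g : G ⧸ H) • m, v⟩ := smul_inv_smul _ _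
      rw [hv', hΦ] at h2
      exact ⟨v', eq_of_heq (Bundle.TotalSpace.mk.inj h2).2⟩
  exact ⟨T.trans (LinearEquiv.ofBijective Φ hbij), fun w => by
    change g • f w = _
    rw [hT, hΦ]; rfl⟩

end VectG

namespace VectGUnion

/-- A frame of `ξ` over a point of `X`: a `G`-equivariant map of the canonical model to `ξ` that
maps the fibres isomorphically to the fibres over one orbit in `M`. -/
@[ext]
structure Frame (c : RightModuleMap H) (A : VectGUnion X ρ F) : Type u where
  toFun : CanonicalModel ρ F c → A.bundle.Total
  fibreIso : ∀ q : G ⧸ H, A.bundle.IsFibreIso (q • (toFun ⟨1, 0⟩).proj) (fun w => toFun ⟨q, w⟩)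
  map_smul : ∀ (g : G) (y : CanonicalModel ρ F c), toFun (g • y) = g • toFun y

namespace Frame

variable {c : RightModuleMap H} {A : VectGUnion X ρ F}

/-- The point of `M` to which a frame maps the neutral element of `G₀`. -/
def pt (p : Frame c A) : A.base.Total := (p.toFun ⟨1, 0⟩).proj

theorem proj_apply (p : Frame c A) (y : CanonicalModel ρ F c) :
    (p.toFun y).proj = y.base • p.pt := (p.fibreIso y.base).proj y.vec

theorem projX_apply (p : Frame c A) (y : CanonicalModel ρ F c) :
    A.projX (p.toFun y) = A.base.proj p.pt := by
  rw [projX, proj_apply, A.base.proj_smul]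

theorem injective (p : Frame c A) : Function.Injective p.toFun := by
  rintro ⟨q, w⟩ ⟨q', w'⟩ h
  have h1 := congrArg Bundle.TotalSpace.proj h
  rw [proj_apply, proj_apply] at h1
  obtain rfl : q = q' := A.base.smul_left_cancel' h1
  rw [(p.fibreIso q).injective h]

theorem exists_apply_eq (p : Frame c A) {t : A.bundle.Total}
    (h : A.projX t = A.base.proj p.pt) : ∃ y, p.toFun y = t := by
  obtain ⟨q, hq⟩ := A.base.exists_smul_eq (p := p.pt) (q := t.proj) h.symm
  obtain ⟨w, hw⟩ := (p.fibreIso q).exists_eq hq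
  exact ⟨⟨q, w⟩, hw⟩

/-- Automorphisms of the canonical model act on frames by `T • p = p ∘ T⁻¹`. -/
noncomputable instance : SMul (CanonicalModel.Aut ρ F c) (Frame c A) where
  smul T p :=
    { toFun := fun y => p.toFun (T⁻¹.1 y)
      fibreIso := by
        intro q
        obtain ⟨a, B, hB⟩ := T⁻¹.2.1
        have h1 : a q = q * a 1 := by
          have := CanonicalModel.aut_apply_base ρ F c T⁻¹ ⟨q, 0⟩
          rw [hB, hB] at this
          exact this
        have h2 := (p.fibreIso (a q)).comp (B q)
        change A.bundle.IsFibreIso (a q • p.pt) _ at h2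
        rw [h1, mul_smul] at h2
        rw [hB, proj_apply]
        convert h2 using 2 with w
        rw [hB, h1]
      map_smul := fun g y => by
        rw [T⁻¹.2.2, p.map_smul] }

theorem smul_apply (T : CanonicalModel.Aut ρ F c) (p : Frame c A) (y : CanonicalModel ρ F c) :
    (T • p).toFun y = p.toFun (T⁻¹.1 y) := rfl

noncomputable instance : MulAction (CanonicalModel.Aut ρ F c) (Frame c A) where
  one_smul p := Frame.ext (funext fun y => by rw [smul_apply, inv_one]; rfl)
  mul_smul S T p := Frame.ext (funext fun y => by
    rw [smul_apply, smul_apply, smul_apply, mul_inv_rev]; rfl)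

/-- On base points, the action on frames is the action of `G₀` on `M` through `pr`. -/
theorem pt_smul (T : CanonicalModel.Aut ρ F c) (p : Frame c A) :
    (T • p).pt = CanonicalModel.pr ρ F c T • p.pt := by
  rw [pt, smul_apply, proj_apply]
  congr 1
  have := map_inv (CanonicalModel.pr ρ F c) T⁻¹
  rw [inv_inv] at this
  rw [this]
  exact (inv_inv _).symm

/-- The automorphisms of the canonical model act transitively on the frames over a point. -/
theorem exists_smul_eq {p p' : Frame c A} (h : A.base.proj p.pt = A.base.proj p'.pt) :
    ∃ T : CanonicalModel.Aut ρ F c, p' = T • p := by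
  have hr : Set.range p'.toFun = Set.range p.toFun := by
    ext t
    constructor
    · rintro ⟨y, rfl⟩
      exact p.exists_apply_eq (by rw [projX_apply, h])
    · rintro ⟨y, rfl⟩
      exact p'.exists_apply_eq (by rw [projX_apply, h])
  let S : Equiv.Perm (CanonicalModel ρ F c) :=
    ((Equiv.ofInjective _ p'.injective).trans (Equiv.setCongr hr)).trans
      (Equiv.ofInjective _ p.injective).symm
  have hS : ∀ y, p.toFun (S y) = p'.toFun y := fun y =>
    Equiv.apply_ofInjective_symm p.injective ⟨p'.toFun y, _⟩
  obtain ⟨a, ha⟩ := A.base.exists_smul_eq h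
  have hmem : S ∈ CanonicalModel.aut ρ F c := by
    constructor
    · have : ∀ q, ∃ B : (F ⊗[ℂ] V) ≃ₗ[ℂ] (F ⊗[ℂ] V), ∀ w,
          p.toFun ⟨q * a, B w⟩ = p'.toFun ⟨q, w⟩ := fun q => by
        have h1 := p.fibreIso (q * a)
        have h2 := p'.fibreIso q
        change A.bundle.IsFibreIso (q • p'.pt) _ at h2
        rw [ha, ← mul_smul] at h2
        exact h1.exists_comp_eq h2
      choose B hB using this
      refine ⟨Equiv.mulRight a, B, fun q w => p.injective ?_⟩
      rw [hS]
      exact (hB q w).symm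
    · intro g y
      apply p.injective
      rw [hS, p.map_smul, p'.map_smul, hS]
  refine ⟨(⟨S, hmem⟩ : CanonicalModel.Aut ρ F c)⁻¹, Frame.ext (funext fun y => ?_)⟩
  rw [smul_apply, inv_inv]
  exact (hS y).symm

theorem smul_left_cancel {p : Frame c A} {T T' : CanonicalModel.Aut ρ F c}
    (h : T • p = T' • p) : T = T' := by
  have : T⁻¹ = T'⁻¹ := Subtype.ext (Equiv.ext fun y => p.injective (by
    rw [← smul_apply, ← smul_apply, h]))
  exact inv_injective this

/-- Frames carry the topology of pointwise convergence. -/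
noncomputable instance : TopologicalSpace (Frame c A) :=
  TopologicalSpace.induced Frame.toFun inferInstance

theorem continuous_apply (y : CanonicalModel ρ F c) :
    Continuous (fun p : Frame c A => p.toFun y) :=
  (_root_.continuous_apply y).comp (continuous_induced_dom (f := Frame.toFun))

theorem continuous_rng {Z : Type*} [TopologicalSpace Z] {f : Z → Frame c A}
    (h : ∀ y, Continuous (fun z => (f z).toFun y)) : Continuous f :=
  continuous_induced_rng.2 (continuous_pi h)

end Frame

end VectGUnion

end

/-! ### Local product structure of a `G`-vector bundle -/

section

variable {X G : Type u} [TopologicalSpace X] [TopologicalSpace G] [DiscreteTopology G] [Group G]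
  {H : Subgroup G} [H.Normal]
  {V : Type u} [NormedAddCommGroup V] [InnerProductSpace ℂ V] [FiniteDimensional ℂ V]
  {ρ : Representation ℂ H V} {F : Type u} [NormedAddCommGroup F] [InnerProductSpace ℂ F]
  [FiniteDimensional ℂ F]

namespace CanonicalModel

variable {c : RightModuleMap H}

/-- On the fibre over the neutral element, `H` acts by `id ⊗ ρ`; on the other fibres it acts by
conjugates of this. -/
theorem phi_stationary (h : H) :
    phi ρ F c (h : G) (1 : G ⧸ H) = LinearMap.lTensor F (ρ h) := by
  change phi ρ F c (h : G) ((1 : G) : G ⧸ H) = _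
  rw [phi_mk, c.map_one, inv_one, mul_one, mul_one]
  have := c.map_mul 1 h
  rw [one_mul, c.map_one, one_mul] at this
  rw [this]

/-- A map of `Z` times the canonical model is open if it is open on each sheet. -/
theorem isOpenMap_of_sheets {Z Y : Type*} [TopologicalSpace Z] [TopologicalSpace Y]
    {f : Z × CanonicalModel ρ F c → Y}
    (h : ∀ q : G ⧸ H, IsOpenMap (fun z : Z × (F ⊗[ℂ] V) => f (z.1, ⟨q, z.2⟩))) :
    IsOpenMap f := by
  intro O hO
  have : f '' O = ⋃ q : G ⧸ H, (fun z : Z × (F ⊗[ℂ] V) => f (z.1, ⟨q, z.2⟩)) ''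
      ((fun z : Z × (F ⊗[ℂ] V) => (z.1, (⟨q, z.2⟩ : CanonicalModel ρ F c))) ⁻¹' O) := by
    ext y
    simp only [Set.mem_iUnion]
    constructor
    · rintro ⟨⟨z, ⟨q, w⟩⟩, hz, rfl⟩
      exact ⟨q, (z, w), hz, rfl⟩
    · rintro ⟨q, ⟨z, w⟩, hz, rfl⟩
      exact ⟨_, hz, rfl⟩
  rw [this]
  exact isOpen_iUnion fun q => h q _
    (hO.preimage (continuous_fst.prodMk ((continuous_mk q).comp continuous_snd)))

theorem continuous_of_sheets {Z Y : Type*} [TopologicalSpace Z] [TopologicalSpace Y]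
    {f : Z × CanonicalModel ρ F c → Y}
    (h : ∀ q : G ⧸ H, Continuous (fun z : Z × (F ⊗[ℂ] V) => f (z.1, ⟨q, z.2⟩))) :
    Continuous f := by
  have h1 : Continuous (fun z : (G ⧸ H) × (Z × (F ⊗[ℂ] V)) => f (z.2.1, ⟨z.1, z.2.2⟩)) :=
    continuous_prod_of_discrete_left.2 h
  exact h1.comp (g := fun z : (G ⧸ H) × (Z × (F ⊗[ℂ] V)) => f (z.2.1, ⟨z.1, z.2.2⟩))
    (f := fun z : Z × CanonicalModel ρ F c => (z.2.base, (z.1, z.2.vec)))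
    ((continuous_base.comp continuous_snd).prodMk
      (continuous_fst.prodMk (continuous_vec.comp continuous_snd)))

end CanonicalModel

namespace VectGUnion

open TensorBundle CanonicalModel

variable (c : RightModuleMap H) (A : VectGUnion X ρ F)

/-- The stationary subgroup acts in a tensor chart as it does on the model fibre. -/
theorem smul_chart
    (e₀ : Bundle.Trivialization F (Bundle.TotalSpace.proj : Bundle.TotalSpace F A.bundle.Fib → _))
    [MemTrivializationAtlas e₀] (m : e₀.baseSet) (h : H) (w : F ⊗[ℂ] V) :
    (h : G) • chart e₀ (m, w) = chart e₀ (m, LinearMap.lTensor F (ρ h) w) := by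
  rw [chart, A.bundle.smul_stationary, chart]
  congr 1
  change (LinearMap.lTensor _ (ρ h) ∘ₗ LinearMap.rTensor V _) w =
    (LinearMap.rTensor V _ ∘ₗ LinearMap.lTensor F (ρ h)) w
  rw [LinearMap.lTensor_comp_rTensor, LinearMap.rTensor_comp_lTensor]

/-- Locally over `X`, the bundle `ξ` is `G`-equivariantly the product with the canonical model:
a local section of `M` and a trivialization of `ξ₀` give the frame over the sheet of the section,
and the action of `G` carries it to the other sheets. -/
theorem exists_local_frame (x₀ : X) : ∃ U : Set X, IsOpen U ∧ x₀ ∈ U ∧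
    ∃ ψ : U → Frame c A, (∀ x, A.base.proj (ψ x).pt = x) ∧
      IsOpenEmbedding (fun z : U × CanonicalModel ρ F c => (ψ z.1).toFun z.2) := by
  obtain ⟨e, he, hmul⟩ := A.base.locally_trivial x₀
  let σ : X → A.base.Total := fun x => e.toOpenPartialHomeomorph.symm (x, 1)
  have hσ : ContinuousOn σ e.baseSet := e.continuousOn_symm_prodMk_left
  have hσp : ∀ x ∈ e.baseSet, A.base.proj (σ x) = x := fun x hx => e.proj_symm_apply' hx
  let e₀ := trivializationAt F A.bundle.Fib (σ x₀)
  let U : Set X := e.baseSet ∩ σ ⁻¹' e₀.baseSet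
  have hU : IsOpen U := hσ.isOpen_inter_preimage e.open_baseSet e₀.open_baseSet
  let s : U → e₀.baseSet := fun x => ⟨σ x, x.2.2⟩
  have hsc : Continuous s :=
    (hσ.comp_continuous continuous_subtype_val fun x => x.2.1).subtype_mk _
  have hso : IsOpenMap s := by
    intro O hO
    have h1 : IsOpen (Subtype.val '' O : Set X) := hU.isOpenMap_subtype_val O hO
    have h2 : IsOpen (e.toOpenPartialHomeomorph.symm ''
        ((Subtype.val '' O : Set X) ×ˢ ({1} : Set (G ⧸ H)))) := by
      refine e.toOpenPartialHomeomorph.symm.isOpen_image_of_subset_source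
        (h1.prod (isOpen_discrete _)) ?_
      rintro ⟨x, q⟩ ⟨⟨y, -, rfl⟩, -⟩
      exact e.mem_target.2 y.2.1
    convert h2.preimage (continuous_subtype_val (p := (· ∈ e₀.baseSet))) using 1
    ext m
    constructor
    · rintro ⟨x, hx, rfl⟩
      exact ⟨(x, 1), ⟨⟨x, hx, rfl⟩, rfl⟩, rfl⟩
    · rintro ⟨⟨x, q⟩, ⟨⟨y, hy, rfl⟩, hq⟩, hm⟩
      obtain rfl : q = 1 := hq
      exact ⟨y, hy, Subtype.ext hm⟩
  -- the map on the sheet `q`, transported from the sheet `1` by a representative of `q`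
  let f : U → CanonicalModel ρ F c → A.bundle.Total := fun x y =>
    y.base.out • chart e₀ (s x, phi ρ F c y.base.out⁻¹ y.base y.vec)
  have hf : ∀ (x : U) (q : G ⧸ H), A.bundle.IsFibreIso (q • σ x) (fun w => f x ⟨q, w⟩) := by
    intro x q
    have h1 : A.bundle.IsFibreIso (σ x) (fun w => chart e₀ (s x, w)) :=
      ⟨chartFib e₀ (s x), fun w => chart_eq e₀ (s x) w⟩
    have h2 := (h1.comp (phiEquiv ρ F c q.out⁻¹ q)).smul q.out
    rw [QuotientGroup.out_eq'] at h2
    exact h2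
  have hpt : ∀ x : U, (f x ⟨1, 0⟩).proj = σ x := fun x => by
    rw [(hf x 1).proj 0, one_smul]
  let ψ : U → Frame c A := fun x =>
    { toFun := f x
      fibreIso := fun q => by
        rw [hpt]
        exact hf x q
      map_smul := by
        rintro g ⟨q, w⟩
        change (g • q).out • chart e₀ (s x, phi ρ F c (g • q).out⁻¹ (g • q) (phi ρ F c g q w)) =
          g • q.out • chart e₀ (s x, phi ρ F c q.out⁻¹ q w)
        have hh : (g • q).out⁻¹ * (g * q.out) ∈ H := by
          rw [← QuotientGroup.eq, QuotientGroup.out_eq']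
          conv_lhs => rw [← QuotientGroup.out_eq' q]
          rfl
        have h1 : (q.out⁻¹ • q : G ⧸ H) = 1 := by
          have h : ∀ a : G, a⁻¹ • (a : G ⧸ H) = 1 := fun a => by
            change ((a⁻¹ * a : G) : G ⧸ H) = 1
            rw [inv_mul_cancel]
            rfl
          simpa only [QuotientGroup.out_eq'] using h q.out
        have h2 : phi ρ F c (g • q).out⁻¹ (g • q) (phi ρ F c g q w) =
            LinearMap.lTensor F (ρ ⟨_, hh⟩) (phi ρ F c q.out⁻¹ q w) := by
          rw [← phi_stationary (c := c), ← h1, ← phi_mul, ← phi_mul]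
          congr 2
          simp [mul_assoc]
        rw [h2, ← smul_chart, smul_smul, smul_smul]
        congr 1
        simp }
  refine ⟨U, hU, ⟨he, FiberBundle.mem_baseSet_trivializationAt' (σ x₀)⟩, ψ, fun x => ?_, ?_⟩
  · change A.base.proj (f x ⟨1, 0⟩).proj = x
    rw [hpt, hσp _ x.2.1]
  · have hc : ∀ q : G ⧸ H, Continuous (fun z : U × (F ⊗[ℂ] V) =>
        (s z.1, phi ρ F c q.out⁻¹ q z.2)) := fun q =>
      (hsc.comp continuous_fst).prodMk
        ((LinearMap.continuous_of_finiteDimensional _).comp continuous_snd)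
    refine .of_continuous_injective_isOpenMap ?_ ?_ ?_
    · exact continuous_of_sheets fun q =>
        ((continuous_chart e₀).comp (hc q)).const_smul q.out
    · rintro ⟨x, y⟩ ⟨x', y'⟩ h
      have h1 : A.projX (f x y) = A.projX (f x' y') := congrArg A.projX h
      have h2 : ∀ x y, A.projX (f x y) = x := fun x y => by
        change A.base.proj (f x y).proj = x
        rw [(hf x y.base).proj y.vec, A.base.proj_smul, hσp _ x.2.1]
      rw [h2, h2] at h1
      obtain rfl : x = x' := Subtype.ext h1
      exact congrArg _ ((ψ x).injective h)
    · refine isOpenMap_of_sheets fun q => ?_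
      have h1 : IsOpenMap (fun z : U × (F ⊗[ℂ] V) => (s z.1, phi ρ F c q.out⁻¹ q z.2)) :=
        hso.prodMap
          (phiEquiv ρ F c q.out⁻¹ q).toContinuousLinearEquiv.toHomeomorph.isOpenMap
      exact (isOpenMap_smul q.out).comp ((isOpenEmbedding_chart e₀).isOpenMap.comp h1)

end VectGUnion

end

/-! ### The principal bundle of frames -/

/-- A map that is continuous and open in a neighbourhood of each point is continuous and open. -/
theorem continuous_and_isOpenMap_of_local {Y Z : Type u} [TopologicalSpace Y] [TopologicalSpace Z]
    {f : Y → Z} (h : ∀ y, ∃ (W : Type u) (_ : TopologicalSpace W) (i : W → Y),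
      IsOpenEmbedding i ∧ y ∈ Set.range i ∧ Continuous (f ∘ i) ∧ IsOpenMap (f ∘ i)) :
    Continuous f ∧ IsOpenMap f := by
  constructor
  · refine continuous_iff_continuousAt.2 fun y => ?_
    obtain ⟨W, _, i, hi, ⟨w, rfl⟩, hc, -⟩ := h y
    exact hi.continuousAt_iff.1 hc.continuousAt
  · refine isOpenMap_iff_nhds_le.2 fun y => ?_
    obtain ⟨W, _, i, hi, ⟨w, rfl⟩, -, ho⟩ := h y
    rw [← hi.map_nhds_eq, Filter.map_map]
    exact ho.nhds_le w

section

variable {X G : Type u} [TopologicalSpace X] [TopologicalSpace G] [DiscreteTopology G] [Group G]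
  {H : Subgroup G} [H.Normal]
  {V : Type u} [NormedAddCommGroup V] [InnerProductSpace ℂ V] [FiniteDimensional ℂ V]
  {ρ : Representation ℂ H V} {F : Type u} [NormedAddCommGroup F] [InnerProductSpace ℂ F]
  [FiniteDimensional ℂ F]

namespace VectGUnion

open TensorBundle CanonicalModel

variable (c : RightModuleMap H) (A : VectGUnion X ρ F)

theorem continuous_projX : Continuous A.projX :=
  A.base.continuous_proj.comp TensorBundle.continuous_proj

/-- A local frame trivializes the bundle of frames. -/
theorem Frame.exists_trivialization (x₀ : X) :
    ∃ e : Bundle.Trivialization (CanonicalModel.Aut ρ F c)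
      (fun p : Frame c A => A.base.proj p.pt), x₀ ∈ e.baseSet ∧
      ∀ (T : CanonicalModel.Aut ρ F c) (p : Frame c A), A.base.proj p.pt ∈ e.baseSet →
        (e (T • p)).2 = T * (e p).2 := by
  classical
  obtain ⟨U, hU, hx₀, ψ, hψ, hΨ⟩ := A.exists_local_frame c x₀
  have hproj : Continuous (fun p : Frame c A => A.base.proj p.pt) :=
    A.continuous_projX.comp (Frame.continuous_apply ⟨1, 0⟩)
  have hτ : ∀ p : Frame c A, ∃ T : CanonicalModel.Aut ρ F c, ∀ h : A.base.proj p.pt ∈ U,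
      p = T • ψ ⟨_, h⟩ := by
    intro p
    by_cases h : A.base.proj p.pt ∈ U
    · obtain ⟨T, hT⟩ := Frame.exists_smul_eq (hψ ⟨_, h⟩)
      exact ⟨T, fun _ => hT⟩
    · exact ⟨1, fun h' => (h h').elim⟩
  choose τ hτ using hτ
  let s : X → Frame c A := fun x => if h : x ∈ U then ψ ⟨x, h⟩ else ψ ⟨x₀, hx₀⟩
  have hs : ∀ x (h : x ∈ U), s x = ψ ⟨x, h⟩ := fun x h => dif_pos h
  have hsp : ∀ x ∈ U, A.base.proj (s x).pt = x := fun x h => by rw [hs x h, hψ]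
  have hps : ∀ (x : X) (T : CanonicalModel.Aut ρ F c), x ∈ U →
      A.base.proj (T • s x).pt = x := fun x T h => by
    rw [Frame.pt_smul, A.base.proj_smul, hsp x h]
  have hτs : ∀ p : Frame c A, A.base.proj p.pt ∈ U → τ p • s (A.base.proj p.pt) = p :=
    fun p h => by rw [hs _ h]; exact (hτ p h).symm
  have hτ_eq : ∀ (x : X) (T : CanonicalModel.Aut ρ F c), x ∈ U → τ (T • s x) = T :=
    fun x T h => by
      have h1 := hτs (T • s x) (by rw [hps x T h]; exact h)
      rw [hps x T h] at h1
      exact Frame.smul_left_cancel h1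
  have hτc : Continuous (fun p : {p : Frame c A // A.base.proj p.pt ∈ U} => τ p) := by
    have h1 : Continuous (fun p : {p : Frame c A // A.base.proj p.pt ∈ U} => (τ p)⁻¹) := by
      refine continuous_aut_rng fun y => ?_
      have h2 : Continuous (fun p : {p : Frame c A // A.base.proj p.pt ∈ U} =>
          ((⟨A.base.proj p.1.pt, p.2⟩, (τ p)⁻¹.1 y) : U × CanonicalModel ρ F c)) := by
        refine hΨ.isInducing.continuous_iff.2 ?_
        refine ((Frame.continuous_apply y).comp continuous_subtype_val).congr fun p => ?_
        change p.1.toFun y = (τ p.1 • ψ ⟨_, p.2⟩).toFun y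
        rw [← hτ p.1 p.2]
      exact continuous_snd.comp h2
    exact h1.inv.congr fun p => inv_inv (τ p)
  have hsc : Continuous (fun z : U × CanonicalModel.Aut ρ F c => z.2 • ψ z.1) := by
    refine Frame.continuous_rng fun y => ?_
    exact hΨ.continuous.comp (continuous_fst.prodMk
      (CanonicalModel.continuous_eval.comp (continuous_snd.inv.prodMk continuous_const)))
  refine ⟨{ toFun := fun p => (A.base.proj p.pt, τ p)
            invFun := fun z => z.2 • s z.1
            source := {p | A.base.proj p.pt ∈ U}
            target := U ×ˢ Set.univ
            map_source' := fun p hp => ⟨hp, trivial⟩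
            map_target' := fun z hz => by
              change A.base.proj (z.2 • s z.1).pt ∈ U
              rw [hps _ _ hz.1]
              exact hz.1
            left_inv' := hτs
            right_inv' := fun z hz => Prod.ext (hps _ _ hz.1) (hτ_eq _ _ hz.1)
            open_source := hU.preimage hproj
            open_target := hU.prod isOpen_univ
            continuousOn_toFun := hproj.continuousOn.prodMk
              (continuousOn_iff_continuous_domRestrict.2 hτc)
            continuousOn_invFun := ?_
            baseSet := U
            open_baseSet := hU
            source_eq := rfl
            target_eq := rfl
            proj_toFun := fun _ _ => rfl }, hx₀, fun T p hp => ?_⟩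
  · refine continuousOn_iff_continuous_domRestrict.2 ?_
    refine (hsc.comp (f := fun z : (U ×ˢ Set.univ : Set (X × CanonicalModel.Aut ρ F c)) =>
      ((⟨z.1.1, z.2.1⟩, z.1.2) : U × CanonicalModel.Aut ρ F c)) ?_).congr fun z => ?_
    · exact Continuous.prodMk (by fun_prop) (by fun_prop)
    · change _ = z.1.2 • s z.1.1
      rw [hs _ z.2.1]
      rfl
  · change τ (T • p) = T * τ p
    conv_lhs => rw [← hτs p hp, smul_smul]
    exact hτ_eq _ _ hp

/-- The principal bundle of frames of a `G`-vector bundle. -/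
noncomputable def frameBundle : PrincipalBundle X (CanonicalModel.Aut ρ F c) :=
  have hproj : Continuous (fun p : Frame c A => A.base.proj p.pt) :=
    A.continuous_projX.comp (Frame.continuous_apply ⟨1, 0⟩)
  have hsmul : ∀ (T : CanonicalModel.Aut ρ F c) (p : Frame c A),
      A.base.proj (T • p).pt = A.base.proj p.pt := fun T p => by
    rw [Frame.pt_smul, A.base.proj_smul]
  { Total := Frame c A
    contAct := PrincipalBundle.continuous_smul_of_locally_trivial hproj hsmul
      (Frame.exists_trivialization c A)
    proj := fun p => A.base.proj p.pt
    continuous_proj := hproj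
    proj_smul := hsmul
    locally_trivial := Frame.exists_trivialization c A }

variable {c A}

/-- Every vector of `ξ` is in the image of a frame. -/
theorem exists_frame_apply_eq (c : RightModuleMap H) (t : A.bundle.Total) :
    ∃ (p : Frame c A) (y : CanonicalModel ρ F c), p.toFun y = t := by
  obtain ⟨p, hp⟩ := (frameBundle c A).proj_surjective (A.projX t)
  obtain ⟨y, hy⟩ := p.exists_apply_eq hp.symm
  exact ⟨p, y, hy⟩

/-- A continuous local section of the bundle of frames identifies `ξ` locally with the canonical
model. -/
theorem isOpenEmbedding_of_section {U : Set X} (hU : IsOpen U) {s : U → Frame c A}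
    (hs : Continuous s) (hsp : ∀ x, A.base.proj (s x).pt = x) :
    IsOpenEmbedding (fun z : U × CanonicalModel ρ F c => (s z.1).toFun z.2) := by
  have hloc : Continuous (fun z : U × CanonicalModel ρ F c => (s z.1).toFun z.2) ∧
      IsOpenMap (fun z : U × CanonicalModel ρ F c => (s z.1).toFun z.2) := by
    refine continuous_and_isOpenMap_of_local fun ⟨x₀, y₀⟩ => ?_
    obtain ⟨U', hU', hx₀, ψ, hψ, hΨ⟩ := A.exists_local_frame c x₀
    have hψc : Continuous ψ := Frame.continuous_rng fun y =>
      hΨ.continuous.comp (continuous_id.prodMk continuous_const)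
    have hτ : ∀ x : {x : U // (x : X) ∈ U'}, ∃ T : CanonicalModel.Aut ρ F c,
        s x = T • ψ ⟨x.1, x.2⟩ := fun x =>
      Frame.exists_smul_eq ((hψ _).trans (hsp x).symm)
    choose τ hτ using hτ
    have hτc : Continuous τ := by
      rw [← continuousOn_univ]
      refine (frameBundle c A).continuousOn_of_smul_eq
        (s := fun x : {x : U // (x : X) ∈ U'} => ψ ⟨x.1, x.2⟩)
        (t := fun x : {x : U // (x : X) ∈ U'} => s x) ?_ ?_ (fun x _ => hτ x)
      · exact (hψc.comp (by fun_prop)).continuousOn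
      · exact (hs.comp continuous_subtype_val).continuousOn
    let k : ({x : U // (x : X) ∈ U'} × CanonicalModel ρ F c) ≃ₜ
        ({x : U // (x : X) ∈ U'} × CanonicalModel ρ F c) :=
      { toFun := fun z => (z.1, (τ z.1)⁻¹.1 z.2)
        invFun := fun z => (z.1, (τ z.1).1 z.2)
        left_inv := fun z => Prod.ext rfl ((τ z.1).1.apply_symm_apply z.2)
        right_inv := fun z => Prod.ext rfl ((τ z.1).1.symm_apply_apply z.2)
        continuous_toFun := continuous_fst.prodMk (CanonicalModel.continuous_eval.comp
          ((hτc.comp continuous_fst).inv.prodMk continuous_snd))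
        continuous_invFun := continuous_fst.prodMk (CanonicalModel.continuous_eval.comp
          ((hτc.comp continuous_fst).prodMk continuous_snd)) }
    have hj : IsOpenEmbedding (fun x : {x : U // (x : X) ∈ U'} => (⟨x.1, x.2⟩ : U')) := by
      refine .of_comp _ hU'.isOpenEmbedding_subtypeVal ?_
      exact hU.isOpenEmbedding_subtypeVal.comp
        (hU'.preimage continuous_subtype_val).isOpenEmbedding_subtypeVal
    have hf : ((fun z : U × CanonicalModel ρ F c => (s z.1).toFun z.2) ∘
        (Prod.map Subtype.val id : {x : U // (x : X) ∈ U'} × CanonicalModel ρ F c → _)) =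
        (fun z : U' × CanonicalModel ρ F c => (ψ z.1).toFun z.2) ∘
          (Prod.map (fun x : {x : U // (x : X) ∈ U'} => (⟨x.1, x.2⟩ : U')) id) ∘ k := by
      funext z
      change (s z.1).toFun z.2 = (τ z.1 • ψ ⟨z.1.1, z.1.2⟩).toFun z.2
      rw [hτ]
    refine ⟨{x : U // (x : X) ∈ U'} × CanonicalModel ρ F c, inferInstance,
      Prod.map Subtype.val id, ?_, ⟨(⟨x₀, hx₀⟩, y₀), rfl⟩, ?_⟩
    · exact (hU'.preimage continuous_subtype_val).isOpenEmbedding_subtypeVal.prodMap .id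
    · rw [hf]
      have := hΨ.comp ((hj.prodMap .id).comp k.isOpenEmbedding)
      exact ⟨this.continuous, this.isOpenMap⟩
  refine .of_continuous_injective_isOpenMap hloc.1 ?_ hloc.2
  rintro ⟨x, y⟩ ⟨x', y'⟩ h
  have h1 := congrArg A.projX h
  change A.projX ((s x).toFun y) = A.projX ((s x').toFun y') at h1
  rw [Frame.projX_apply, Frame.projX_apply, hsp, hsp] at h1
  obtain rfl : x = x' := Subtype.ext h1
  exact congrArg _ ((s x).injective h)

end VectGUnion

end

/-! ### The frame functor -/

section

variable {X G : Type u} [TopologicalSpace X] [TopologicalSpace G] [DiscreteTopology G] [Group G]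
  {H : Subgroup G} [H.Normal]
  {V : Type u} [NormedAddCommGroup V] [InnerProductSpace ℂ V] [FiniteDimensional ℂ V]
  {ρ : Representation ℂ H V} {F : Type u} [NormedAddCommGroup F] [InnerProductSpace ℂ F]
  [FiniteDimensional ℂ F]

namespace VectGUnion

open TensorBundle CanonicalModel

variable {A B : VectGUnion X ρ F}

theorem Hom.proj_total (f : A ⟶ B) (t : A.bundle.Total) :
    (f.total t).proj = f.base.toFun t.proj := by
  obtain ⟨m, w⟩ := t
  obtain ⟨T, hT⟩ := f.linear m
  rw [hT]

/-- The image of a frame under a morphism of `G`-vector bundles. -/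
noncomputable def Frame.map {c : RightModuleMap H} (f : A ⟶ B) (p : Frame c A) : Frame c B where
  toFun y := f.total (p.toFun y)
  fibreIso q := by
    obtain ⟨S, hS⟩ := p.fibreIso q
    obtain ⟨T, hT⟩ := f.linear (q • p.pt)
    have h : q • (f.total (p.toFun ⟨1, 0⟩)).proj = f.base.toFun (q • p.pt) := by
      rw [Hom.proj_total, f.base.map_smul]
      rfl
    rw [h]
    refine ⟨S.trans T, fun w => ?_⟩
    change f.total (p.toFun ⟨q, w⟩) = _
    exact (congrArg f.total (hS w)).trans (hT (S w))
  map_smul g y := by rw [p.map_smul, f.map_smul]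

/-- The bundle of frames, as a functor. -/
noncomputable def frameFunctor (X : Type u) [TopologicalSpace X] (ρ : Representation ℂ H V)
    (F : Type u) [NormedAddCommGroup F] [InnerProductSpace ℂ F] [FiniteDimensional ℂ F]
    (c : RightModuleMap H) :
    VectGUnion X ρ F ⥤ PrincipalBundle X (CanonicalModel.Aut ρ F c) where
  obj A := frameBundle c A
  map {A B} f :=
    { toFun := fun p : Frame c A => p.map f
      continuous_toFun := Frame.continuous_rng fun y =>
        f.total.continuous.comp (Frame.continuous_apply y)
      map_smul := fun _ _ => rfl
      proj_toFun := fun p => by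
        change B.base.proj (f.total (p.toFun ⟨1, 0⟩)).proj = A.base.proj p.pt
        rw [Hom.proj_total, f.base.proj_toFun]
        rfl }
  map_id _ := rfl
  map_comp _ _ := rfl

theorem hom_ext_total {f f' : A ⟶ B} (h : ∀ t, f.total t = f'.total t) : f = f' := by
  refine Hom.ext (PrincipalBundle.Hom.ext (funext fun m => ?_)) (Homeomorph.ext h)
  have := congrArg Bundle.TotalSpace.proj (h ⟨m, 0⟩)
  rwa [Hom.proj_total, Hom.proj_total] at this

/-- The frames cover the total space, so a morphism is determined by its effect on frames. -/
instance frameFunctor_faithful (c : RightModuleMap H) : (frameFunctor X ρ F c).Faithful where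
  map_injective {A B f f'} h := by
    refine hom_ext_total fun t => ?_
    obtain ⟨p, y, rfl⟩ := exists_frame_apply_eq c t
    have h1 := congrArg (fun φ : frameBundle c A ⟶ frameBundle c B =>
      Frame.toFun (φ.toFun p) y) h
    exact h1

theorem continuous_zeroSection (A : VectGUnion X ρ F) :
    Continuous (fun m => (⟨m, 0⟩ : A.bundle.Total)) := by
  refine continuous_iff_continuousAt.2 fun m => ?_
  let e := trivializationAt F A.bundle.Fib m
  have he : e.baseSet ∈ 𝓝 m :=
    e.open_baseSet.mem_nhds (FiberBundle.mem_baseSet_trivializationAt' m)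
  refine ContinuousOn.continuousAt ?_ he
  refine continuousOn_iff_continuous_domRestrict.2 ?_
  refine ((continuous_chart (V := V) e).comp (continuous_id.prodMk
    (continuous_const (y := 0)))).congr fun m' => ?_
  change chart e (m', 0) = _
  rw [chart_eq, map_zero]
  rfl

theorem smul_zero_vec (A : VectGUnion X ρ F) (g : G) (m : A.base.Total) :
    g • (⟨m, 0⟩ : A.bundle.Total) = ⟨(g : G ⧸ H) • m, 0⟩ := by
  obtain ⟨Φ, hΦ⟩ := A.bundle.smul_linear g m
  rw [hΦ, map_zero]

/-- A map of total spaces is a homeomorphism if it carries `p y` to `φ(p) y`, for a continuous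
equivariant map `φ` of the bundles of frames. -/
theorem isHomeomorph_of_frames {c : RightModuleMap H} {φ : Frame c A → Frame c B}
    (hφc : Continuous φ) (hφs : ∀ (T : CanonicalModel.Aut ρ F c) p, φ (T • p) = T • φ p)
    (hφ : ∀ p, B.base.proj (φ p).pt = A.base.proj p.pt)
    {f : A.bundle.Total → B.bundle.Total}
    (hf : ∀ (p : Frame c A) (y : CanonicalModel ρ F c), f (p.toFun y) = (φ p).toFun y) :
    IsHomeomorph f := by
  have hloc : Continuous f ∧ IsOpenMap f := by
    refine continuous_and_isOpenMap_of_local fun t => ?_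
    obtain ⟨U, hU, hx₀, ψ, hψ, hΨ⟩ := A.exists_local_frame c (A.projX t)
    have hψc : Continuous ψ := Frame.continuous_rng fun y =>
      hΨ.continuous.comp (continuous_id.prodMk continuous_const)
    obtain ⟨y, hy⟩ := (ψ ⟨_, hx₀⟩).exists_apply_eq (hψ ⟨_, hx₀⟩).symm
    refine ⟨U × CanonicalModel ρ F c, inferInstance, _, hΨ, ⟨(⟨_, hx₀⟩, y), hy⟩, ?_⟩
    have h1 := isOpenEmbedding_of_section (A := B) (c := c) hU
      (s := fun x => φ (ψ x)) (hφc.comp hψc)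
      (fun x => (hφ _).trans (hψ x))
    have h2 : (f ∘ fun z : U × CanonicalModel ρ F c => (ψ z.1).toFun z.2) =
        fun z => (φ (ψ z.1)).toFun z.2 := funext fun z => hf _ _
    rw [h2]
    exact ⟨h1.continuous, h1.isOpenMap⟩
  refine ⟨hloc.1, hloc.2, ?_, ?_⟩
  · intro t t' h
    obtain ⟨p, y, rfl⟩ := exists_frame_apply_eq c t
    obtain ⟨p', y', rfl⟩ := exists_frame_apply_eq c t'
    rw [hf, hf] at h
    have h1 := congrArg B.projX h
    rw [Frame.projX_apply, Frame.projX_apply, hφ, hφ] at h1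
    obtain ⟨T, rfl⟩ := Frame.exists_smul_eq h1
    rw [hφs] at h
    have h3 := (φ p).injective h
    rw [h3]
    rfl
  · intro t
    obtain ⟨p', y', rfl⟩ := exists_frame_apply_eq c t
    obtain ⟨p, hp⟩ := (frameBundle c A).proj_surjective (B.base.proj p'.pt)
    change Frame c A at p
    obtain ⟨y, hy⟩ := (φ p).exists_apply_eq (t := p'.toFun y')
      (by rw [Frame.projX_apply, hφ]; exact hp.symm)
    exact ⟨p.toFun y, (hf p y).trans hy⟩

/-- A morphism `φ` of the bundles of frames is induced by the map `p y ↦ φ(p) y` of total spaces,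
which does not depend on the choice of the frame `p`. -/
instance frameFunctor_full (c : RightModuleMap H) : (frameFunctor X ρ F c).Full where
  map_surjective {A B} φ₀ := by
    change frameBundle c A ⟶ frameBundle c B at φ₀
    let φ : Frame c A → Frame c B := φ₀.toFun
    have hφs : ∀ (T : CanonicalModel.Aut ρ F c) p, φ (T • p) = T • φ p := φ₀.map_smul
    have hφp : ∀ p, B.base.proj (φ p).pt = A.base.proj p.pt := φ₀.proj_toFun
    choose P Y hPY using fun t : A.bundle.Total => exists_frame_apply_eq c t
    let f : A.bundle.Total → B.bundle.Total := fun t => (φ (P t)).toFun (Y t)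
    have hf : ∀ (p : Frame c A) (y : CanonicalModel ρ F c),
        f (p.toFun y) = (φ p).toFun y := by
      intro p y
      have h1 : A.base.proj (P (p.toFun y)).pt = A.base.proj p.pt := by
        rw [← Frame.projX_apply _ (Y (p.toFun y)), hPY, Frame.projX_apply]
      obtain ⟨T, hT⟩ := Frame.exists_smul_eq h1
      have h2 : φ p = T • φ (P (p.toFun y)) := by
        conv_lhs => rw [hT]
        exact hφs T _
      have h3 : Y (p.toFun y) = T⁻¹.1 y := by
        apply (P (p.toFun y)).injective
        rw [hPY, ← Frame.smul_apply, ← hT]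
      change (φ (P (p.toFun y))).toFun (Y (p.toFun y)) = _
      rw [h2, h3]
      rfl
    have hsmul : ∀ (g : G) (t : A.bundle.Total), f (g • t) = g • f t := by
      intro g t
      obtain ⟨p, y, rfl⟩ := exists_frame_apply_eq c t
      rw [← p.map_smul, hf, hf]
      exact (φ p).map_smul g y
    have hproj : ∀ t, B.projX (f t) = A.projX t := by
      intro t
      obtain ⟨p, y, rfl⟩ := exists_frame_apply_eq c t
      rw [hf, Frame.projX_apply, Frame.projX_apply]
      exact hφp p
    have hhomeo := isHomeomorph_of_frames φ₀.continuous_toFun hφs hφp hf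
    let b : A.base ⟶ B.base :=
      { toFun := fun m => (f ⟨m, 0⟩).proj
        continuous_toFun := TensorBundle.continuous_proj.comp
          (hhomeo.continuous.comp A.continuous_zeroSection)
        map_smul := fun q m => by
          induction q using QuotientGroup.induction_on with
          | H g => rw [← smul_zero_vec, hsmul, VectG.proj_smul]
        proj_toFun := fun m => hproj ⟨m, 0⟩ }
    let f' : A ⟶ B :=
      { base := b
        total := hhomeo.homeomorph
        linear := fun m => by
          obtain ⟨p, ⟨q, w₀⟩, hp⟩ := exists_frame_apply_eq c (⟨m, 0⟩ : A.bundle.Total)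
          have h1 := p.fibreIso q
          have hm : q • p.pt = m := by
            have := p.proj_apply ⟨q, w₀⟩
            rw [hp] at this
            exact this.symm
          change A.bundle.IsFibreIso (q • p.pt) _ at h1
          rw [hm] at h1
          have h2 := (φ p).fibreIso q
          have hb : q • ((φ p).toFun ⟨1, 0⟩).proj = b.toFun m := by
            change _ = (f ⟨m, 0⟩).proj
            rw [← hp, hf]
            exact ((φ p).proj_apply ⟨q, w₀⟩).symm
          rw [hb] at h2
          obtain ⟨S, hS⟩ := h1
          obtain ⟨T, hT⟩ := h2
          refine ⟨S.symm.trans T, fun w => ?_⟩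
          have h3 := hS (S.symm w)
          rw [LinearEquiv.apply_symm_apply] at h3
          change f ⟨m, w⟩ = _
          rw [← h3, hf]
          exact hT _
        map_smul := hsmul }
    exact ⟨f', PrincipalBundle.Hom.ext (funext fun p => Frame.ext (funext fun y => hf p y))⟩

/-! ### Gluing and transition functions -/

/-- Gluing from the canonical model along `Ψ` amounts to having frames with the transition
functions `Ψ`. -/
theorem isGluedFrom_iff_hasCocycle {c : RightModuleMap H} {ι : Type u} {U : ι → Set X}
    {Ψ : ι → ι → X → CanonicalModel.Aut ρ F c} (hU : ∀ i, IsOpen (U i))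
    (hc : (⋃ i, U i) = Set.univ) :
    A.IsGluedFrom c U Ψ ↔ (frameBundle c A).HasCocycle U Ψ := by
  classical
  constructor
  · rintro ⟨s, ψ, -, hsp, -, hψ, hsmul, hΨ⟩
    let S' : ∀ i, U i → Frame c A := fun i x =>
      { toFun := fun y => ψ i (x, y)
        fibreIso := fun q => by
          have h1 : (ψ i (x, ⟨1, 0⟩) : A.bundle.Total).proj = s i x := by
            obtain ⟨T, hT⟩ := hψ i x 1
            exact (congrArg Bundle.TotalSpace.proj (hT 0)).trans (one_smul _ _)
          rw [h1]
          exact hψ i x q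
        map_smul := fun g y => hsmul i x g y }
    have hpt : ∀ i x, (S' i x).pt = s i x := fun i x => by
      obtain ⟨T, hT⟩ := hψ i x 1
      exact (congrArg Bundle.TotalSpace.proj (hT 0)).trans (one_smul _ _)
    choose p₀ hp₀ using (frameBundle c A).proj_surjective
    -- the values outside `U i` are irrelevant
    let S : ι → X → Frame c A := fun i x => if h : x ∈ U i then S' i ⟨x, h⟩ else p₀ x
    have hS : ∀ i x (h : x ∈ U i), S i x = S' i ⟨x, h⟩ := fun i x h => dif_pos h
    refine ⟨hU, hc, S, fun i => ?_, fun i x hx => ?_, fun i j x hx => ?_⟩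
    · refine continuousOn_iff_continuous_domRestrict.2 (Frame.continuous_rng fun y => ?_)
      refine (continuous_subtype_val.comp ((ψ i).continuous.comp
        (continuous_id.prodMk (continuous_const (y := y))))).congr fun x => ?_
      change _ = (S i x).toFun y
      rw [hS i x x.2]
      rfl
    · rw [hS i x hx]
      change A.base.proj (S' i ⟨x, hx⟩).pt = x
      rw [hpt, hsp i x hx]
    · rw [hS i x hx.1, hS j x hx.2]
      refine Frame.ext (funext fun y => ?_)
      change (ψ j (⟨x, hx.2⟩, y) : A.bundle.Total) = ψ i (⟨x, hx.1⟩, (Ψ i j x)⁻¹.1 y)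
      rw [← hΨ i j x hx.1 hx.2]
      congr 3
      exact ((Ψ i j x).1.apply_symm_apply y).symm
  · rintro ⟨-, -, S, hS, hSp, hSΨ⟩
    change ι → X → Frame c A at S
    have hSp' : ∀ i, ∀ x ∈ U i, A.base.proj (S i x).pt = x := hSp
    have hSc : ∀ i, Continuous (fun x : U i => S i x) := fun i =>
      continuousOn_iff_continuous_domRestrict.1 (hS i)
    have hemb := fun i => isOpenEmbedding_of_section (hU i) (hSc i) (fun x => hSp' i x x.2)
    have hrange : ∀ i, Set.range (fun z : U i × CanonicalModel ρ F c => (S i z.1).toFun z.2) =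
        {t | A.projX t ∈ U i} := by
      intro i
      ext t
      constructor
      · rintro ⟨z, rfl⟩
        change A.projX ((S i z.1).toFun z.2) ∈ U i
        rw [Frame.projX_apply, hSp' i _ z.1.2]
        exact z.1.2
      · intro ht
        obtain ⟨y, hy⟩ := (S i (A.projX t)).exists_apply_eq (t := t) (hSp' i _ ht).symm
        exact ⟨(⟨_, ht⟩, y), hy⟩
    refine ⟨fun i x => (S i x).pt,
      fun i => (hemb i).isEmbedding.toHomeomorph.trans (Homeomorph.setCongr (hrange i)),
      fun i => ?_, hSp', fun i j x hx => ?_, fun i x q => (S i x).fibreIso q,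
      fun i x g y => (S i x).map_smul g y, fun i j x hi hj y => ?_⟩
    · exact (TensorBundle.continuous_proj.comp
        (Frame.continuous_apply ⟨1, 0⟩)).comp_continuousOn (hS i)
    · have h1 : S j x = Ψ i j x • S i x := hSΨ i j x hx
      change (S j x).pt = _
      rw [h1, Frame.pt_smul]
    · have h1 : S j x = Ψ i j x • S i x := hSΨ i j x ⟨hi, hj⟩
      change (S j x).toFun ((Ψ i j x).1 y) = (S i x).toFun y
      rw [h1, Frame.smul_apply]
      congr 1
      exact (Ψ i j x).1.symm_apply_apply y

end VectGUnion

end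

/-! ### Irreducible representations and operators on `F ⊗ V` -/

section

variable {Γ : Type*} [Group Γ] {F V : Type u} [NormedAddCommGroup F] [InnerProductSpace ℂ F]
  [NormedAddCommGroup V] [InnerProductSpace ℂ V]

namespace Representation

/-- Schur's lemma over `ℂ`. -/
theorem IsIrreducible.exists_eq_smul [FiniteDimensional ℂ V] {ρ : Representation ℂ Γ V}
    (hρ : ρ.IsIrreducible) (f : V →ₗ[ℂ] V) (hf : ∀ g v, f (ρ g v) = ρ g (f v)) :
    ∃ a : ℂ, ∀ v, f v = a • v := by
  let f' : IntertwiningMap ρ ρ := LinearMap.intertwiningMap_of_isIntertwiningMap ρ ρ f hf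
  obtain ⟨a, ha⟩ :=
    (IsIrreducible.algebraMap_intertwiningMap_bijective_of_isAlgClosed
      (k := ℂ) (ρ := ρ)).2 f'
  refine ⟨a, fun v => ?_⟩
  exact (congrArg (fun φ : IntertwiningMap ρ ρ => φ.toLinearMap v) ha).symm

theorem IsIrreducible.nontrivial {ρ : Representation ℂ Γ V} (hρ : ρ.IsIrreducible) :
    Nontrivial V := by
  by_contra h
  rw [not_nontrivial_iff_subsingleton] at h
  refine bot_ne_top (α := Subrepresentation ρ) (SetLike.ext fun v => ?_)
  rw [Subsingleton.elim v 0]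
  exact iff_of_true (zero_mem (⊥ : Subrepresentation ρ).toSubmodule)
    (zero_mem (⊤ : Subrepresentation ρ).toSubmodule)

/-- Averaging over the group annihilates a non-trivial irreducible representation. -/
theorem IsIrreducible.sum_eq_zero [Fintype Γ] {ρ : Representation ℂ Γ V}
    (hρ : ρ.IsIrreducible) (h : ∃ g, ρ g ≠ 1) : ∑ g, ρ g = 0 := by
  let N : Subrepresentation ρ := ⟨ρ.invariants, fun g v hv => by rwa [hv g]⟩
  have hinv : ∀ v, (∑ g, ρ g) v ∈ ρ.invariants := fun v g => by
    simp only [LinearMap.sum_apply, map_sum]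
    simp only [← Module.End.mul_apply, ← map_mul]
    exact Fintype.sum_equiv (Equiv.mulLeft g) _ _ fun _ => rfl
  rcases hρ.eq_bot_or_eq_top N with hN | hN
  · ext v
    have h1 : (∑ g, ρ g) v ∈ N.toSubmodule := hinv v
    rw [hN] at h1
    exact h1
  · obtain ⟨g, hg⟩ := h
    refine (hg (LinearMap.ext fun v => ?_)).elim
    have h1 : v ∈ N.toSubmodule := by
      rw [hN]
      trivial
    exact h1 g

end Representation

namespace TensorProduct

/-- The slices `(ℓ ⊗ id) w` with functionals `ℓ` on `F` determine `w ∈ F ⊗ V`. -/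
theorem ext_of_dual_left {w w' : F ⊗[ℂ] V}
    (h : ∀ ℓ : F →ₗ[ℂ] ℂ, TensorProduct.lid ℂ V (LinearMap.rTensor V ℓ w) =
      TensorProduct.lid ℂ V (LinearMap.rTensor V ℓ w')) : w = w' := by
  classical
  let b := Module.Basis.ofVectorSpace ℂ F
  apply (TensorProduct.equivFinsuppOfBasisLeft b).injective
  ext i
  simp only [TensorProduct.equivFinsuppOfBasisLeft_apply]
  exact h _

end TensorProduct

namespace TensorBundle

variable [FiniteDimensional ℂ F] [FiniteDimensional ℂ V]

/-- The partial contraction of an endomorphism of `F ⊗ V` with a vector `v₀` and a functional `ℓ`,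
as an endomorphism of `F`. -/
noncomputable def contract (v₀ : V) (ℓ : V →ₗ[ℂ] ℂ) :
    ((F ⊗[ℂ] V) →L[ℂ] (F ⊗[ℂ] V)) →ₗ[ℂ] (F →L[ℂ] F) where
  toFun A := LinearMap.toContinuousLinearMap
    ((TensorProduct.rid ℂ F).toLinearMap ∘ₗ LinearMap.lTensor F ℓ ∘ₗ A.toLinearMap ∘ₗ
      (TensorProduct.mk ℂ F V).flip v₀)
  map_add' A B := by ext; simp
  map_smul' r A := by ext; simp

theorem contract_apply (v₀ : V) (ℓ : V →ₗ[ℂ] ℂ) (A : (F ⊗[ℂ] V) →L[ℂ] (F ⊗[ℂ] V)) (f : F) :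
    contract v₀ ℓ A f = TensorProduct.rid ℂ F (LinearMap.lTensor F ℓ (A (f ⊗ₜ v₀))) := rfl

theorem contract_rTensor {v₀ : V} {ℓ : V →ₗ[ℂ] ℂ} (h : ℓ v₀ = 1) (B : F →L[ℂ] F) :
    contract v₀ ℓ (rTensorₗ B) = B := by
  ext f
  rw [contract_apply]
  change TensorProduct.rid ℂ F (LinearMap.lTensor F ℓ (LinearMap.rTensor V _ (f ⊗ₜ v₀))) = _
  simp [h]

/-- Schur's lemma with multiplicities: an operator on `F ⊗ V` that commutes with `id ⊗ ρ` acts on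
`F` only. -/
theorem rTensor_contract {ρ : Representation ℂ Γ V} (hρ : ρ.IsIrreducible) {v₀ : V}
    {ℓ : V →ₗ[ℂ] ℂ} (h : ℓ v₀ = 1) (A : (F ⊗[ℂ] V) →L[ℂ] (F ⊗[ℂ] V))
    (hA : ∀ g w, A (LinearMap.lTensor F (ρ g) w) = LinearMap.lTensor F (ρ g) (A w)) :
    rTensorₗ (contract v₀ ℓ A) = A := by
  have hcomm : ∀ (k : F →ₗ[ℂ] ℂ) (g : Γ) (w : F ⊗[ℂ] V),
      TensorProduct.lid ℂ V (LinearMap.rTensor V k (LinearMap.lTensor F (ρ g) w)) =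
        ρ g (TensorProduct.lid ℂ V (LinearMap.rTensor V k w)) := by
    intro k g w
    induction w using TensorProduct.induction_on with
    | zero => simp
    | tmul f v => simp
    | add a b ha hb => simp only [map_add, ha, hb]
  have hcontr : ∀ (k : F →ₗ[ℂ] ℂ) (w : F ⊗[ℂ] V),
      k (TensorProduct.rid ℂ F (LinearMap.lTensor F ℓ w)) =
        ℓ (TensorProduct.lid ℂ V (LinearMap.rTensor V k w)) := by
    intro k w
    induction w using TensorProduct.induction_on with
    | zero => simp
    | tmul f v => simp [mul_comm]
    | add a b ha hb => simp only [map_add, ha, hb]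
  have key : (rTensorₗ (contract v₀ ℓ A)).toLinearMap = A.toLinearMap := by
    refine TensorProduct.ext' fun f v => TensorProduct.ext_of_dual_left fun k => ?_
    obtain ⟨a, ha⟩ := hρ.exists_eq_smul
      ((TensorProduct.lid ℂ V).toLinearMap ∘ₗ LinearMap.rTensor V k ∘ₗ A.toLinearMap ∘ₗ
        TensorProduct.mk ℂ F V f) (fun g v => by
          have h1 := hA g (f ⊗ₜ v)
          rw [LinearMap.lTensor_tmul] at h1
          change TensorProduct.lid ℂ V (LinearMap.rTensor V k (A (f ⊗ₜ ρ g v))) = _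
          rw [h1, hcomm]
          rfl)
    have ha' : ∀ v, TensorProduct.lid ℂ V (LinearMap.rTensor V k (A (f ⊗ₜ v))) = a • v := ha
    change TensorProduct.lid ℂ V (LinearMap.rTensor V k
      (LinearMap.rTensor V (contract v₀ ℓ A).toLinearMap (f ⊗ₜ v))) =
        TensorProduct.lid ℂ V (LinearMap.rTensor V k (A (f ⊗ₜ v)))
    rw [ha', LinearMap.rTensor_tmul, LinearMap.rTensor_tmul, TensorProduct.lid_tmul]
    change k (contract v₀ ℓ A f) • v = _
    rw [contract_apply, hcontr, ha', map_smul, h, smul_eq_mul, mul_one]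
  exact ContinuousLinearMap.coe_injective key

end TensorBundle

end

/-! ### Coordinates on the fibres of the canonical model in which `H` acts by `id ⊗ ρ` -/

section

variable {X G : Type u} [TopologicalSpace X] [TopologicalSpace G] [DiscreteTopology G] [Group G]
  {H : Subgroup G} [H.Normal]
  {V : Type u} [NormedAddCommGroup V] [InnerProductSpace ℂ V] [FiniteDimensional ℂ V]

namespace CanonicalModel

open TensorBundle

theorem stationary_smul (h : H) (q : G ⧸ H) : (h : G) • q = q := by
  induction q using QuotientGroup.induction_on with
  | H g =>
    have h1 : g⁻¹ * ((h : G) * g) ∈ H := by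
      simpa [mul_assoc] using ‹H.Normal›.conj_mem h h.2 g⁻¹
    exact (QuotientGroup.eq.2 h1).symm

theorem smul_eq_mk_mul (g : G) (q : G ⧸ H) : g • q = (g : G ⧸ H) * q := by
  induction q using QuotientGroup.induction_on with
  | H a => rfl

/-- A decomposition of the fibres of the canonical model as `F ⊗ V` with `H` acting by `id ⊗ ρ`: the
isomorphisms `E q` carry `id ⊗ ρ` to the action of `H` on the fibre over `q`. In the resulting
coordinates an automorphism `T` acts on the fibre over `q` by `b T q ⊗ id`, with an operator `b T q`
on `F`. The `b T q` are the transition functions for gluing `ξ₀`. -/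
structure FibreSplitting (ρ : Representation ℂ H V) (F : Type u) [NormedAddCommGroup F]
    [InnerProductSpace ℂ F] [FiniteDimensional ℂ F] (c : RightModuleMap H) where
  E : G ⧸ H → ((F ⊗[ℂ] V) ≃ₗ[ℂ] (F ⊗[ℂ] V))
  b : Aut ρ F c → G ⧸ H → (F →L[ℂ] F)
  phi_E : ∀ (h : H) q w, phi ρ F c (h : G) q (E q w) = E q (LinearMap.lTensor F (ρ h) w)
  fiberMap_E : ∀ T q w,
    fiberMap T q (E q w) = E (q * (pr ρ F c T)⁻¹) (rTensorₗ (b T q) w)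
  continuous_b : Continuous (fun p : Aut ρ F c × (G ⧸ H) => b p.1 p.2)
  b_one : ∀ q, b 1 q = 1
  b_mul : ∀ S T q, b (S * T) q = b S (q * (pr ρ F c T)⁻¹) * b T q

variable {ρ : Representation ℂ H V} {F : Type u} [NormedAddCommGroup F] [InnerProductSpace ℂ F]
  [FiniteDimensional ℂ F]

/-- Over `[g]`, the subgroup `H` acts by `ρ` precomposed with a conjugation, which is equivalent to
`ρ` by the conjugation invariance. -/
theorem exists_intertwiner (c : RightModuleMap H)
    (hconj : ∀ g : G, ∃ C : V ≃ₗ[ℂ] V, ∀ (h : H) (v : V),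
      ρ (MulAut.conjNormal g⁻¹ h) (C v) = C (ρ h v)) (q : G ⧸ H) :
    ∃ E : (F ⊗[ℂ] V) ≃ₗ[ℂ] (F ⊗[ℂ] V), ∀ (h : H) w,
      phi ρ F c (h : G) q (E w) = E (LinearMap.lTensor F (ρ h) w) := by
  induction q using QuotientGroup.induction_on with
  | H g =>
    obtain ⟨C, hC⟩ := hconj g
    have hu : ∀ x : H, ρ x * ρ x⁻¹ = 1 := fun x => by rw [← map_mul, mul_inv_cancel, map_one]
    have hu' : ∀ x : H, ρ x⁻¹ * ρ x = 1 := fun x => by rw [← map_mul, inv_mul_cancel, map_one]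
    let R : V ≃ₗ[ℂ] V := LinearEquiv.ofLinearMap (ρ (c.toFun g)) (ρ (c.toFun g)⁻¹) (hu _) (hu' _)
    refine ⟨LinearEquiv.lTensor F (C.trans R), fun h w => ?_⟩
    have h1 : c.toFun ((h : G) * g) * (c.toFun g)⁻¹ =
        c.toFun g * MulAut.conjNormal g⁻¹ h * (c.toFun g)⁻¹ := by
      have h2 : (h : G) * g = g * (MulAut.conjNormal g⁻¹ h : H) := by
        rw [MulAut.conjNormal_apply]
        group
      rw [h2, c.map_mul]
    have h2 : ρ (c.toFun ((h : G) * g) * (c.toFun g)⁻¹) ∘ₗ (C.trans R).toLinearMap =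
        (C.trans R).toLinearMap ∘ₗ ρ h := by
      ext v
      rw [h1]
      change ρ (c.toFun g * MulAut.conjNormal g⁻¹ h * (c.toFun g)⁻¹) (ρ (c.toFun g) (C v)) =
        ρ (c.toFun g) (C (ρ h v))
      rw [← hC, ← Module.End.mul_apply, ← Module.End.mul_apply, ← map_mul, ← map_mul,
        inv_mul_cancel_right]
    rw [phi_mk]
    change (LinearMap.lTensor F _ ∘ₗ LinearMap.lTensor F (C.trans R).toLinearMap) w =
      (LinearMap.lTensor F (C.trans R).toLinearMap ∘ₗ LinearMap.lTensor F (ρ h)) w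
    rw [← LinearMap.lTensor_comp, ← LinearMap.lTensor_comp, h2]

/-- Conjugation invariance of `ρ` gives the isomorphisms `E q`, and Schur's lemma the operators
`b T q`; their continuity holds since they are contractions of the fibre maps of `T`. -/
theorem nonempty_fibreSplitting (hρ : ρ.IsIrreducible) (c : RightModuleMap H)
    (hconj : ∀ g : G, ∃ C : V ≃ₗ[ℂ] V, ∀ (h : H) (v : V),
      ρ (MulAut.conjNormal g⁻¹ h) (C v) = C (ρ h v)) :
    Nonempty (FibreSplitting ρ F c) := by
  choose E hE using exists_intertwiner (F := F) c hconj
  have := hρ.nontrivial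
  obtain ⟨v₀, hv₀⟩ := exists_ne (0 : V)
  obtain ⟨ℓ, hℓ⟩ := SeparatingDual.exists_eq_one (R := ℂ) hv₀
  -- an operator from the fibre over `q` to the fibre over `r`, in the coordinates `E`
  let conj (q r : G ⧸ H) : ((F ⊗[ℂ] V) →L[ℂ] (F ⊗[ℂ] V)) →ₗ[ℂ] ((F ⊗[ℂ] V) →L[ℂ] (F ⊗[ℂ] V)) :=
    { toFun := fun A => LinearMap.toContinuousLinearMap
        ((E r).symm.toLinearMap ∘ₗ A.toLinearMap ∘ₗ (E q).toLinearMap)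
      map_add' := fun A B => by ext; simp
      map_smul' := fun a A => by ext; simp }
  have conj_apply : ∀ q r A w, conj q r A w = (E r).symm (A (E q w)) := fun _ _ _ _ => rfl
  let b : Aut ρ F c → G ⧸ H → (F →L[ℂ] F) := fun T q =>
    contract v₀ ℓ.toLinearMap (conj q (q * (pr ρ F c T)⁻¹) (fiberMap T q))
  have hb : ∀ T q, rTensorₗ (b T q) = conj q (q * (pr ρ F c T)⁻¹) (fiberMap T q) := by
    intro T q
    refine rTensor_contract hρ hℓ _ fun h w => ?_
    rw [conj_apply, conj_apply, ← hE, LinearEquiv.symm_apply_eq, ← hE,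
      LinearEquiv.apply_symm_apply]
    have h1 := fiberMap_phi T (h : G) q (E q w)
    rwa [stationary_smul] at h1
  have hb_inj : ∀ B B' : F →L[ℂ] F, rTensorₗ (V := V) B = rTensorₗ B' → B = B' := by
    intro B B' h
    rw [← contract_rTensor (ℓ := ℓ.toLinearMap) hℓ B, h, contract_rTensor hℓ]
  have hb' : ∀ T q w,
      fiberMap T q (E q w) = E (q * (pr ρ F c T)⁻¹) (rTensorₗ (b T q) w) := fun T q w => by
    rw [hb, conj_apply, LinearEquiv.apply_symm_apply]
  have hbc : Continuous (fun p : Aut ρ F c × (G ⧸ H) => b p.1 p.2) := by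
    refine continuous_prod_of_discrete_right.2 fun q => ?_
    have h1 : Continuous (fun z : (G ⧸ H) × ((F ⊗[ℂ] V) →L[ℂ] (F ⊗[ℂ] V)) =>
        contract v₀ ℓ.toLinearMap (conj q z.1 z.2)) := by
      refine continuous_prod_of_discrete_left.2 fun r => ?_
      exact LinearMap.continuous_of_finiteDimensional
        (contract v₀ ℓ.toLinearMap ∘ₗ conj q r)
    have h2 : Continuous (fun T : Aut ρ F c => (q * (pr ρ F c T)⁻¹, fiberMap T q)) :=
      ((continuous_of_discreteTopology (f := fun x : G ⧸ H => q * x⁻¹)).comp continuous_pr).prodMk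
        (continuous_fiberMap.comp (continuous_id.prodMk continuous_const))
    have h3 := h1.comp h2
    refine h3.congr fun T => ?_
    simp only [Function.comp_apply, b]
  clear_value b
  refine ⟨⟨E, b, fun h q w => hE q h w, hb', hbc, fun q => hb_inj _ _ ?_,
    fun S T q => hb_inj _ _ ?_⟩⟩
  · ext1 w
    apply (E (q * (pr ρ F c (1 : Aut ρ F c))⁻¹)).injective
    rw [← hb', map_one, inv_one, mul_one, fiberMap_one]
    change E q w = E q (LinearMap.rTensor V LinearMap.id w)
    rw [LinearMap.rTensor_id]
    rfl
  · ext1 w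
    apply (E (q * (pr ρ F c (S * T))⁻¹)).injective
    have h1 : rTensorₗ (b S (q * (pr ρ F c T)⁻¹) * b T q) w =
        rTensorₗ (b S (q * (pr ρ F c T)⁻¹)) (rTensorₗ (b T q) w) :=
      LinearMap.rTensor_comp_apply V _ _ w
    have h2 : q * (pr ρ F c (S * T))⁻¹ = q * (pr ρ F c T)⁻¹ * (pr ρ F c S)⁻¹ := by
      rw [map_mul, mul_inv_rev, mul_assoc]
    have h3 : fiberMap (S * T) q (E q w) =
        fiberMap S (q * (pr ρ F c T)⁻¹) (fiberMap T q (E q w)) := by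
      rw [fiberMap_mul]
      rfl
    rw [← hb', h1, h3, hb', hb', h2]

namespace FibreSplitting

variable {c : RightModuleMap H} (S : FibreSplitting ρ F c)

/-- The canonical action of `g` from the fibre over `q`, in the coordinates of the splitting. -/
noncomputable def D (g : G) (q : G ⧸ H) : (F ⊗[ℂ] V) →ₗ[ℂ] (F ⊗[ℂ] V) :=
  (S.E (g • q)).symm.toLinearMap ∘ₗ phi ρ F c g q ∘ₗ (S.E q).toLinearMap

theorem E_D (g : G) (q : G ⧸ H) (w : F ⊗[ℂ] V) :
    S.E (g • q) (S.D g q w) = phi ρ F c g q (S.E q w) :=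
  LinearEquiv.apply_symm_apply _ _

theorem D_one (q : G ⧸ H) (w : F ⊗[ℂ] V) : S.D 1 q w = w := by
  apply (S.E ((1 : G) • q)).injective
  rw [E_D, phi_one, one_smul]

theorem D_mul (g g' : G) (q : G ⧸ H) (w : F ⊗[ℂ] V) :
    S.D (g * g') q w = S.D g (g' • q) (S.D g' q w) := by
  apply (S.E ((g * g') • q)).injective
  rw [E_D, phi_mul, ← E_D, ← E_D, mul_smul]

theorem D_stationary (h : H) (q : G ⧸ H) (w : F ⊗[ℂ] V) :
    S.D (h : G) q w = LinearMap.lTensor F (ρ h) w := by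
  apply (S.E ((h : G) • q)).injective
  rw [E_D, S.phi_E, stationary_smul]

/-- In coordinates, the automorphisms commute with the action of `G`. -/
theorem rTensor_D (T : Aut ρ F c) (g : G) (q : G ⧸ H) (w : F ⊗[ℂ] V) :
    rTensorₗ (S.b T (g • q)) (S.D g q w) =
      S.D g (q * (pr ρ F c T)⁻¹) (rTensorₗ (S.b T q) w) := by
  have hq : g • q * (pr ρ F c T)⁻¹ = g • (q * (pr ρ F c T)⁻¹) := by
    rw [smul_eq_mk_mul, smul_eq_mk_mul, mul_assoc]
  apply (S.E (g • q * (pr ρ F c T)⁻¹)).injective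
  rw [← S.fiberMap_E, E_D, fiberMap_phi, S.fiberMap_E, hq, E_D]

end FibreSplitting

end CanonicalModel

end

/-! ### Gluing a `G`-vector bundle from a cocycle -/

section

variable {X G : Type u} [TopologicalSpace X] [TopologicalSpace G] [DiscreteTopology G] [Group G]
  {H : Subgroup G} [H.Normal]
  {V : Type u} [NormedAddCommGroup V] [InnerProductSpace ℂ V] [FiniteDimensional ℂ V]

open TensorBundle CanonicalModel

/-- A continuous cocycle on `X` with values in the automorphism group of the canonical model, with
the choice of a member of the cover around each point. -/
structure AutCocycle (X : Type u) [TopologicalSpace X] (ρ : Representation ℂ H V) (F : Type u)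
    [NormedAddCommGroup F] [InnerProductSpace ℂ F] (c : RightModuleMap H) (ι : Type u) where
  U : ι → Set X
  isOpen : ∀ i, IsOpen (U i)
  index : X → ι
  mem_index : ∀ x, x ∈ U (index x)
  Ψ : ι → ι → X → CanonicalModel.Aut ρ F c
  continuousOn : ∀ i j, ContinuousOn (Ψ i j) (U i ∩ U j)
  self : ∀ i, ∀ x ∈ U i, Ψ i i x = 1
  mul : ∀ i j k, ∀ x ∈ U i ∩ U j ∩ U k, Ψ j k x * Ψ i j x = Ψ i k x

namespace AutCocycle

variable {ρ : Representation ℂ H V} {F : Type u} [NormedAddCommGroup F] [InnerProductSpace ℂ F]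
  [FiniteDimensional ℂ F] {c : RightModuleMap H} {ι : Type u} (Z : AutCocycle X ρ F c ι)

/-- The transition functions of the base bundle: right translations on the fibre `G₀`. -/
noncomputable def baseCore : FiberBundleCore ι X (G ⧸ H) where
  baseSet := Z.U
  isOpen_baseSet := Z.isOpen
  indexAt := Z.index
  mem_baseSet_at := Z.mem_index
  -- with `s j = a • s i`, the point `q • s i` is `(q * a⁻¹) • s j`
  coordChange i j x q := q * (pr ρ F c (Z.Ψ i j x))⁻¹
  coordChange_self i x hx q := by rw [Z.self i x hx, map_one, inv_one, mul_one]
  continuousOn_coordChange i j := by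
    have h : ContinuousOn (fun p : X × (G ⧸ H) => (p.2, pr ρ F c (Z.Ψ i j p.1)))
        ((Z.U i ∩ Z.U j) ×ˢ Set.univ) :=
      continuousOn_snd.prodMk (continuous_pr.comp_continuousOn
        ((Z.continuousOn i j).comp continuousOn_fst fun p hp => hp.1))
    exact (continuous_of_discreteTopology
      (f := fun x : (G ⧸ H) × (G ⧸ H) => x.1 * x.2⁻¹)).comp_continuousOn h
  coordChange_comp i j k x hx q := by
    rw [mul_assoc, ← mul_inv_rev, ← map_mul, Z.mul i j k x hx]

/-- The group `G₀` acts on the base bundle by left translations in the fibres. -/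
noncomputable instance : MulAction (G ⧸ H) Z.baseCore.TotalSpace where
  smul q m := ⟨m.proj, (q * (show G ⧸ H from m.snd) : G ⧸ H)⟩
  one_smul m := Bundle.TotalSpace.ext rfl (heq_of_eq (one_mul (show G ⧸ H from m.snd)))
  mul_smul q q' m :=
    Bundle.TotalSpace.ext rfl (heq_of_eq (mul_assoc q q' (show G ⧸ H from m.snd)))

theorem base_locally_trivial (x : X) : ∃ e : Bundle.Trivialization (G ⧸ H) Z.baseCore.proj,
    x ∈ e.baseSet ∧ ∀ (q : G ⧸ H) (m : Z.baseCore.TotalSpace), Z.baseCore.proj m ∈ e.baseSet →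
      (e (q • m)).2 = q * (e m).2 :=
  ⟨Z.baseCore.localTriv (Z.index x), Z.mem_index x, fun q m _ =>
    mul_assoc q (show G ⧸ H from m.snd) _⟩

/-- The principal `G₀`-bundle with the transition functions `pr ∘ Ψ`. -/
noncomputable def base : PrincipalBundle X (G ⧸ H) where
  Total := Z.baseCore.TotalSpace
  contAct := PrincipalBundle.continuous_smul_of_locally_trivial Z.baseCore.continuous_proj
    (fun _ _ => rfl) Z.base_locally_trivial
  proj := Z.baseCore.proj
  continuous_proj := Z.baseCore.continuous_proj
  proj_smul _ _ := rfl
  locally_trivial := Z.base_locally_trivial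

/-- The coordinate of a point of the base bundle in the `i`-th trivialization. -/
noncomputable def coord (i : ι) (m : Z.base.Total) : G ⧸ H := (Z.baseCore.localTriv i m).2

/-- The point of the base bundle over `x` with the coordinate `q` in the `i`-th trivialization. -/
noncomputable def point (i : ι) (x : X) (q : G ⧸ H) : Z.base.Total :=
  (Z.baseCore.localTriv i).toOpenPartialHomeomorph.symm (x, q)

theorem coord_smul (i : ι) (q : G ⧸ H) (m : Z.base.Total) :
    Z.coord i (q • m) = q * Z.coord i m :=
  mul_assoc q (show G ⧸ H from Bundle.TotalSpace.snd (show Z.baseCore.TotalSpace from m)) _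

theorem coord_change (i j : ι) (m : Z.base.Total) (hi : Z.base.proj m ∈ Z.U i)
    (hj : Z.base.proj m ∈ Z.U j) :
    Z.coord j m = Z.coord i m * (pr ρ F c (Z.Ψ i j (Z.base.proj m)))⁻¹ :=
  (Z.baseCore.coordChange_comp (Z.index (Z.base.proj m)) i j (Z.base.proj m)
    ⟨⟨Z.mem_index _, hi⟩, hj⟩ _).symm

theorem proj_point (i : ι) (x : X) (q : G ⧸ H) : Z.base.proj (Z.point i x q) = x := rfl

theorem coord_point (i : ι) {x : X} (hx : x ∈ Z.U i) (q : G ⧸ H) :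
    Z.coord i (Z.point i x q) = q :=
  congrArg Prod.snd ((Z.baseCore.localTriv i).apply_symm_apply' (x := q) hx)

theorem smul_point (i : ι) (x : X) (q q' : G ⧸ H) :
    q' • Z.point i x q = Z.point i x (q' * q) :=
  Bundle.TotalSpace.ext rfl (heq_of_eq (mul_assoc q' q _).symm)

theorem point_change (i j : ι) {x : X} (hi : x ∈ Z.U i) (hj : x ∈ Z.U j) (q : G ⧸ H) :
    Z.point j x (q * (pr ρ F c (Z.Ψ i j x))⁻¹) = Z.point i x q :=
  Bundle.TotalSpace.ext rfl (heq_of_eq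
    (Z.baseCore.coordChange_comp i j (Z.index x) x ⟨⟨hi, hj⟩, Z.mem_index x⟩ q))

theorem continuousOn_point (i : ι) (q : G ⧸ H) :
    ContinuousOn (fun x => Z.point i x q) (Z.U i) :=
  (Z.baseCore.localTriv i).continuousOn_symm_prodMk_left

theorem continuousOn_coord (i : ι) :
    ContinuousOn (Z.coord i) (Z.base.proj ⁻¹' Z.U i) :=
  continuous_snd.comp_continuousOn (Z.baseCore.localTriv i).continuousOn_toFun

variable (S : FibreSplitting ρ F c)

/-- The transition functions of the bundle `ξ₀`. -/
noncomputable def fibreCore : VectorBundleCore ℂ Z.base.Total F ι where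
  baseSet i := Z.base.proj ⁻¹' Z.U i
  isOpen_baseSet i := (Z.isOpen i).preimage Z.base.continuous_proj
  indexAt m := Z.index (Z.base.proj m)
  mem_baseSet_at m := Z.mem_index _
  coordChange i j m := S.b (Z.Ψ i j (Z.base.proj m)) (Z.coord i m)
  coordChange_self i m hm v := by
    rw [Z.self i _ hm, S.b_one]
    rfl
  continuousOn_coordChange i j := by
    refine S.continuous_b.comp_continuousOn (ContinuousOn.prodMk ?_ ?_)
    · exact (Z.continuousOn i j).comp Z.base.continuous_proj.continuousOn fun m hm => hm
    · exact (Z.continuousOn_coord i).mono fun m hm => hm.1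
  coordChange_comp i j k m hm v := by
    rw [← Z.mul i j k _ hm, S.b_mul, ← Z.coord_change i j m hm.1.1 hm.1.2]
    rfl

/-- The total space of the glued bundle `ξ₀ ⊗ V`. -/
abbrev GluedTotal : Type u := TensorTotal F V (Z.fibreCore S).Fiber

/-- A point of `ξ₀ ⊗ V` over `m`, by its coordinates in the preferred trivialization at `m`. -/
noncomputable def gluedPt (m : Z.base.Total) (w : F ⊗[ℂ] V) : Z.GluedTotal S := ⟨m, w⟩

/-- The coordinate of `m` in the preferred trivialization at `m`. -/
noncomputable def coordAt (m : Z.base.Total) : G ⧸ H := Z.coord (Z.index (Z.base.proj m)) m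

theorem coordAt_smul (q : G ⧸ H) (m : Z.base.Total) : Z.coordAt (q • m) = q * Z.coordAt m :=
  Z.coord_smul _ q m

theorem exists_gluedPt_eq (t : Z.GluedTotal S) : ∃ m w, Z.gluedPt S m w = t :=
  ⟨t.proj, t.snd, rfl⟩

/-- The action of `G`, which is the canonical one in the coordinates given by `S`. It is defined in
the preferred trivialization at each point; `smul_gluedChart` shows that it has the same form in
all others. -/
noncomputable instance : SMul G (Z.GluedTotal S) where
  smul g t := Z.gluedPt S ((g : G ⧸ H) • t.proj) (S.D g (Z.coordAt t.proj) t.snd)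

theorem smul_gluedPt (g : G) (m : Z.base.Total) (w : F ⊗[ℂ] V) :
    g • Z.gluedPt S m w = Z.gluedPt S ((g : G ⧸ H) • m) (S.D g (Z.coordAt m) w) := rfl

noncomputable instance : MulAction G (Z.GluedTotal S) where
  one_smul t := by
    obtain ⟨m, w, rfl⟩ := Z.exists_gluedPt_eq S t
    rw [smul_gluedPt, S.D_one, QuotientGroup.mk_one, one_smul]
  mul_smul g g' t := by
    obtain ⟨m, w, rfl⟩ := Z.exists_gluedPt_eq S t
    rw [smul_gluedPt, smul_gluedPt, smul_gluedPt, S.D_mul, coordAt_smul, smul_eq_mk_mul,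
      QuotientGroup.mk_mul, mul_smul]

instance (i : ι) : MemTrivializationAtlas ((Z.fibreCore S).localTriv i) := ⟨⟨i, rfl⟩⟩

/-- The chart of the glued bundle in the `i`-th trivialization of `ξ₀`. -/
noncomputable def gluedChart (i : ι) (m : Z.base.Total) (hm : Z.base.proj m ∈ Z.U i)
    (w : F ⊗[ℂ] V) : Z.GluedTotal S :=
  chart ((Z.fibreCore S).localTriv i) (⟨m, hm⟩, w)

theorem exists_gluedChart_eq (i : ι) (m : Z.base.Total) (hm : Z.base.proj m ∈ Z.U i) :
    ∃ T : (F ⊗[ℂ] V) ≃ₗ[ℂ] ((Z.fibreCore S).Fiber m ⊗[ℂ] V),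
      ∀ w, Z.gluedChart S i m hm w = ⟨m, T w⟩ :=
  ⟨chartFib ((Z.fibreCore S).localTriv i) ⟨m, hm⟩, chart_eq _ _⟩

theorem gluedChart_eq (i : ι) (m : Z.base.Total) (hm : Z.base.proj m ∈ Z.U i) (w : F ⊗[ℂ] V) :
    Z.gluedChart S i m hm w =
      Z.gluedPt S m (rTensorₗ (S.b (Z.Ψ i (Z.index (Z.base.proj m)) (Z.base.proj m))
        (Z.coord i m)) w) := by
  have h : ((Z.fibreCore S).localTriv i).symmₗ ℂ m =
      (S.b (Z.Ψ i (Z.index (Z.base.proj m)) (Z.base.proj m)) (Z.coord i m)).toLinearMap := by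
    ext1 v
    rw [Bundle.Trivialization.symmₗ_apply _ hm]
    exact (Z.fibreCore S).localTriv_symm_apply i hm v
  change (⟨m, LinearMap.rTensor V (((Z.fibreCore S).localTriv i).symmₗ ℂ m) w⟩ :
    Z.GluedTotal S) = _
  rw [h]
  rfl

/-- The action has the same form in all charts, since automorphisms of the canonical model commute
with the action of `G`. -/
theorem smul_gluedChart (g : G) (i : ι) (m : Z.base.Total) (hm : Z.base.proj m ∈ Z.U i)
    (w : F ⊗[ℂ] V) :
    g • Z.gluedChart S i m hm w =
      Z.gluedChart S i ((g : G ⧸ H) • m) (by rwa [Z.base.proj_smul])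
        (S.D g (Z.coord i m) w) := by
  rw [gluedChart_eq, gluedChart_eq, smul_gluedPt, coord_smul, ← smul_eq_mk_mul,
    Z.base.proj_smul, S.rTensor_D, ← Z.coord_change i _ m hm (Z.mem_index _)]
  rfl

theorem gluedChart_change (i j : ι) (m : Z.base.Total) (hi : Z.base.proj m ∈ Z.U i)
    (hj : Z.base.proj m ∈ Z.U j) (w : F ⊗[ℂ] V) :
    Z.gluedChart S i m hi w =
      Z.gluedChart S j m hj (rTensorₗ (S.b (Z.Ψ i j (Z.base.proj m)) (Z.coord i m)) w) := by
  have h : (((Z.fibreCore S).localTriv i).coordChangeL ℂ ((Z.fibreCore S).localTriv j) m :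
      F →L[ℂ] F) = S.b (Z.Ψ i j (Z.base.proj m)) (Z.coord i m) :=
    ContinuousLinearMap.ext fun v => (Z.fibreCore S).localTriv_coordChange_eq i j ⟨hi, hj⟩ v
  rw [← h]
  exact chart_change _ ((Z.fibreCore S).localTriv j) m hi hj w

theorem continuous_gluedChart {Y : Type*} [TopologicalSpace Y] (i : ι) {f : Y → Z.base.Total}
    (hf : Continuous f) (hf' : ∀ y, Z.base.proj (f y) ∈ Z.U i) {k : Y → F ⊗[ℂ] V}
    (hk : Continuous k) : Continuous (fun y => Z.gluedChart S i (f y) (hf' y) (k y)) :=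
  (continuous_chart ((Z.fibreCore S).localTriv i)).comp ((hf.subtype_mk hf').prodMk hk)

instance : ContinuousConstSMul G (Z.GluedTotal S) where
  continuous_const_smul g := by
    refine continuous_of_chart fun e he => ?_
    obtain ⟨i, rfl⟩ := he.out
    have h1 : Continuous (fun m : {m // Z.base.proj m ∈ Z.U i} => Z.coord i m) :=
      (Z.continuousOn_coord i).comp_continuous continuous_subtype_val fun m => m.2
    have h2 : Continuous (fun z : (G ⧸ H) × (F ⊗[ℂ] V) => S.D g z.1 z.2) :=
      continuous_prod_of_discrete_left.2 fun q => (S.D g q).continuous_of_finiteDimensional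
    have h3 : Continuous (fun z : {m // Z.base.proj m ∈ Z.U i} × (F ⊗[ℂ] V) =>
        (g : G ⧸ H) • (z.1 : Z.base.Total)) :=
      (continuous_subtype_val.comp continuous_fst).const_smul (g : G ⧸ H)
    have h4 := Z.continuous_gluedChart S i h3
      (fun z => by rw [Z.base.proj_smul]; exact z.1.2)
      (h2.comp ((h1.comp continuous_fst).prodMk continuous_snd))
    exact h4.congr fun z => (Z.smul_gluedChart S g i z.1 z.1.2 z.2).symm

/-- The `G`-vector bundle glued from the canonical model along a cocycle. -/
noncomputable def glued : VectGUnion X ρ F where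
  base := Z.base
  bundle :=
    { Fib := (Z.fibreCore S).Fiber
      smul_linear := fun g m => ⟨S.D g (Z.coordAt m), fun w => rfl⟩
      smul_stationary := fun h m w => by
        have h1 : ((h : G) : G ⧸ H) = 1 := (QuotientGroup.eq_one_iff _).2 h.2
        have h2 : ∀ w : F ⊗[ℂ] V,
            (h : G) • Z.gluedPt S m w = Z.gluedPt S m (LinearMap.lTensor F (ρ h) w) := fun w => by
          rw [smul_gluedPt, h1, one_smul, S.D_stationary]
        exact h2 w }

/-- The frames of the glued bundle that are given by its construction. -/
noncomputable def frame (i : ι) (x : Z.U i) : VectGUnion.Frame c (Z.glued S) where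
  toFun y := Z.gluedChart S i (Z.point i x y.base) x.2 ((S.E y.base).symm y.vec)
  fibreIso q := by
    have h1 : q • Z.point i x 1 = Z.point i x q := by rw [smul_point, mul_one]
    change (Z.glued S).bundle.IsFibreIso (q • Z.point i x 1) _
    rw [h1]
    obtain ⟨T, hT⟩ := Z.exists_gluedChart_eq S i (Z.point i x q) x.2
    exact ⟨(S.E q).symm.trans T, fun w => hT _⟩
  map_smul g y := by
    refine Eq.trans ?_
      (Z.smul_gluedChart S g i (Z.point i x y.base) x.2 ((S.E y.base).symm y.vec)).symm
    have h1 : (g : G ⧸ H) • Z.point i x y.base = Z.point i x (g • y.base) := by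
      rw [smul_point, smul_eq_mk_mul]
    have h2 : S.D g y.base ((S.E y.base).symm y.vec) =
        (S.E (g • y.base)).symm (phi ρ F c g y.base y.vec) := by
      rw [LinearEquiv.eq_symm_apply, S.E_D, LinearEquiv.apply_symm_apply]
    simp only [coord_point _ _ x.2, h1, h2]
    rfl

theorem pt_frame (i : ι) (x : Z.U i) : (Z.frame S i x).pt = Z.point i x 1 := rfl

/-- The frames of the glued bundle transform by the given cocycle. -/
theorem frame_change (i j : ι) (x : X) (hi : x ∈ Z.U i) (hj : x ∈ Z.U j)
    (y : CanonicalModel ρ F c) :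
    (Z.frame S j ⟨x, hj⟩).toFun ((Z.Ψ i j x).1 y) = (Z.frame S i ⟨x, hi⟩).toFun y := by
  obtain ⟨q, w⟩ := y
  rw [aut_apply]
  have h1 := Z.point_change i j hi hj q
  have h2 : (S.E (q * (pr ρ F c (Z.Ψ i j x))⁻¹)).symm (fiberMap (Z.Ψ i j x) q w) =
      rTensorₗ (S.b (Z.Ψ i j x) q) ((S.E q).symm w) := by
    rw [LinearEquiv.symm_apply_eq, ← S.fiberMap_E, LinearEquiv.apply_symm_apply]
  change Z.gluedChart S j (Z.point j x (q * (pr ρ F c (Z.Ψ i j x))⁻¹)) hj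
      ((S.E (q * (pr ρ F c (Z.Ψ i j x))⁻¹)).symm (fiberMap (Z.Ψ i j x) q w)) =
    Z.gluedChart S i (Z.point i x q) hi ((S.E q).symm w)
  refine Eq.trans ?_ (Z.gluedChart_change S i j (Z.point i x q) hi hj ((S.E q).symm w)).symm
  simp only [proj_point, coord_point _ _ hi, h1, h2]

/-- The frame bundle of the glued bundle has the given cocycle. -/
theorem hasCocycle_frameBundle :
    (VectGUnion.frameBundle c (Z.glued S)).HasCocycle Z.U Z.Ψ := by
  classical
  choose p₀ hp₀ using (VectGUnion.frameBundle c (Z.glued S)).proj_surjective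
  -- the values outside `U i` are irrelevant
  let s : ι → X → VectGUnion.Frame c (Z.glued S) := fun i x =>
    if h : x ∈ Z.U i then Z.frame S i ⟨x, h⟩ else p₀ x
  have hs : ∀ i x (h : x ∈ Z.U i), s i x = Z.frame S i ⟨x, h⟩ := fun i x h => dif_pos h
  refine ⟨Z.isOpen, Set.eq_univ_of_forall fun x => Set.mem_iUnion.2 ⟨_, Z.mem_index x⟩, s,
    fun i => ?_, fun i x hx => ?_, fun i j x hx => ?_⟩
  · refine continuousOn_iff_continuous_domRestrict.2 (VectGUnion.Frame.continuous_rng fun y => ?_)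
    have h1 : Continuous (fun x : Z.U i => Z.point i x y.base) :=
      continuousOn_iff_continuous_domRestrict.1 (Z.continuousOn_point i y.base)
    refine (Z.continuous_gluedChart S i h1 (fun x => x.2)
      (continuous_const (y := (S.E y.base).symm y.vec))).congr fun x => ?_
    change _ = (s i x).toFun y
    rw [hs i x x.2]
    rfl
  · rw [hs i x hx]
    change Z.base.proj (Z.frame S i ⟨x, hx⟩).pt = x
    rw [pt_frame, proj_point]
  · rw [hs i x hx.1, hs j x hx.2]
    refine VectGUnion.Frame.ext (funext fun y => ?_)
    obtain ⟨y', rfl⟩ := (Z.Ψ i j x).1.surjective y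
    refine (Z.frame_change S i j x hx.1 hx.2 y').trans ?_
    change _ = (Z.frame S i ⟨x, hx.1⟩).toFun ((Z.Ψ i j x).1.symm ((Z.Ψ i j x).1 y'))
    rw [Equiv.symm_apply_apply]

end AutCocycle

/-- The transition functions of a principal bundle form a cocycle, along which the canonical model
can be glued; the frame bundle of the result has the same transition functions. -/
theorem PrincipalBundle.HasCocycle.exists_frameBundle {ρ : Representation ℂ H V} {F : Type u}
    [NormedAddCommGroup F] [InnerProductSpace ℂ F] [FiniteDimensional ℂ F] {c : RightModuleMap H}
    (S : FibreSplitting ρ F c) {P : PrincipalBundle X (CanonicalModel.Aut ρ F c)} {ι : Type u}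
    {U : ι → Set X} {Ψ : ι → ι → X → CanonicalModel.Aut ρ F c} (hP : P.HasCocycle U Ψ) :
    ∃ A : VectGUnion X ρ F, (VectGUnion.frameBundle c A).HasCocycle U Ψ := by
  obtain ⟨hU, hc, s, hs, hsp, hsΨ⟩ := hP
  have hix : ∀ x, ∃ i, x ∈ U i := fun x => Set.mem_iUnion.1 (hc ▸ Set.mem_univ x)
  choose k hk using hix
  let Z : AutCocycle X ρ F c ι :=
    { U := U
      isOpen := hU
      index := k
      mem_index := hk
      Ψ := Ψ
      continuousOn := fun i j => P.continuousOn_of_smul_eq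
        ((hs i).mono Set.inter_subset_left) ((hs j).mono Set.inter_subset_right) (hsΨ i j)
      self := fun i x hx => P.smul_left_cancel'
        ((hsΨ i i x ⟨hx, hx⟩).symm.trans (one_smul _ _).symm)
      mul := fun i j k x hx => P.smul_left_cancel' (p := s i x) (by
        rw [mul_smul, ← hsΨ i j x hx.1, ← hsΨ j k x ⟨hx.1.2, hx.2⟩,
          ← hsΨ i k x ⟨hx.1.1, hx.2⟩]) }
  exact ⟨Z.glued S, Z.hasCocycle_frameBundle S⟩

end

/-! ### The equivalence of categories and the vectors fixed by `H` -/

section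

variable {X G : Type u} [TopologicalSpace X] [TopologicalSpace G] [DiscreteTopology G] [Group G]
  {H : Subgroup G} [H.Normal]
  {V : Type u} [NormedAddCommGroup V] [InnerProductSpace ℂ V] [FiniteDimensional ℂ V]
  {ρ : Representation ℂ H V} {F : Type u} [NormedAddCommGroup F] [InnerProductSpace ℂ F]
  [FiniteDimensional ℂ F] {c : RightModuleMap H}

namespace VectGUnion

/-- Essential surjectivity holds because principal bundles with the same transition functions are
isomorphic. -/
theorem isEquivalence_frameFunctor (S : CanonicalModel.FibreSplitting ρ F c) :
    (frameFunctor X ρ F c).IsEquivalence :=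
  { essSurj :=
      { mem_essImage := fun P => by
          obtain ⟨ι, U, Ψ, hP⟩ := P.exists_hasCocycle
          obtain ⟨A, hA⟩ := hP.exists_frameBundle S
          exact ⟨A, hA.nonempty_iso hP⟩ } }

/-- The transition functions of `M` are the images of those of the frame bundle under `pr`. -/
theorem IsGluedFrom.hasCocycle_base {A : VectGUnion X ρ F} {ι : Type u} {U : ι → Set X}
    {Ψ : ι → ι → X → CanonicalModel.Aut ρ F c} (h : A.IsGluedFrom c U Ψ)
    (hU : ∀ i, IsOpen (U i)) (hc : (⋃ i, U i) = Set.univ) :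
    A.base.HasCocycle U (fun i j x => CanonicalModel.pr ρ F c (Ψ i j x)) := by
  obtain ⟨s, -, hs, hsp, hsΨ, -⟩ := h
  exact ⟨hU, hc, s, hs, hsp, hsΨ⟩

/-- Averaging over `H`: the sum of the operators `ρ h` vanishes, while it multiplies a fixed vector
by the order of `H`. -/
theorem snd_eq_zero_of_fixed [Finite H] (hρ : ρ.IsIrreducible) (h : ∃ h : H, ρ h ≠ 1)
    (A : VectGUnion X ρ F) (t : A.bundle.Total) (ht : ∀ h : H, (h : G) • t = t) : t.snd = 0 := by
  have := Fintype.ofFinite H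
  obtain ⟨m, w⟩ := t
  have h1 : ∀ h : H, LinearMap.lTensor (A.bundle.Fib m) (ρ h) w = w := fun h =>
    eq_of_heq (Bundle.TotalSpace.mk.inj ((A.bundle.smul_stationary h m w).symm.trans (ht h))).2
  have h2 : LinearMap.lTensor (A.bundle.Fib m) (∑ h : H, ρ h) w = (Fintype.card H : ℂ) • w := by
    rw [← LinearMap.coe_lTensorHom, map_sum, LinearMap.sum_apply]
    simp only [LinearMap.coe_lTensorHom, h1, Finset.sum_const, Finset.card_univ]
    exact (Nat.cast_smul_eq_nsmul ℂ _ _).symm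
  rw [hρ.sum_eq_zero h, LinearMap.lTensor_zero, LinearMap.zero_apply] at h2
  exact (smul_eq_zero.1 h2.symm).resolve_left (Nat.cast_ne_zero.2 Fintype.card_ne_zero)

end VectGUnion

end

theorem mainTheorem1 {X G F V : Type u} [TopologicalSpace X] [CompactSpace X]
    [TopologicalSpace G] [DiscreteTopology G] [Group G]
    (H : Subgroup G) [H.Normal] [Finite H]
    [NormedAddCommGroup F] [InnerProductSpace ℂ F] [FiniteDimensional ℂ F]
    [NormedAddCommGroup V] [InnerProductSpace ℂ V] [FiniteDimensional ℂ V]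
    (ρ : Representation ℂ H V) (hρ : ρ.IsIrreducible)
    (hconj : ∀ g : G, ∃ C : V ≃ₗ[ℂ] V, ∀ (h : H) (v : V),
      ρ (MulAut.conjNormal g⁻¹ h) (C v) = C (ρ h v))
    (c : RightModuleMap H) :
    (∃ e : PrincipalBundle X (CanonicalModel.Aut ρ F c) ≌ VectGUnion X ρ F,
      ∀ (P : PrincipalBundle X (CanonicalModel.Aut ρ F c)) (ι : Type u) (U : ι → Set X)
        (Ψ : ι → ι → X → CanonicalModel.Aut ρ F c), P.HasCocycle U Ψ →
        (e.functor.obj P).base.HasCocycle U (fun i j x => CanonicalModel.pr ρ F c (Ψ i j x)) ∧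
        ∀ A : VectGUnion X ρ F,
          A.IsGluedFrom c U Ψ ↔ Nonempty (e.functor.obj P ≅ A)) ∧
    ((∃ h : H, ρ h ≠ 1) → ∀ (A : VectGUnion X ρ F) (t : A.bundle.Total),
      (∀ h : H, (h : G) • t = t) → t.snd = 0) := by
  refine ⟨?_, fun h A t ht => VectGUnion.snd_eq_zero_of_fixed hρ h A t ht⟩
  obtain ⟨S⟩ := CanonicalModel.nonempty_fibreSplitting (F := F) hρ c hconj
  let Φ := VectGUnion.frameFunctor X ρ F c
  have : Φ.IsEquivalence := VectGUnion.isEquivalence_frameFunctor S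
  refine ⟨Φ.asEquivalence.symm, fun P ι U Ψ hP => ?_⟩
  -- the frame bundle of the object corresponding to `P` is isomorphic to `P`
  have hA := hP.of_hom (Φ.asEquivalence.counitIso.inv.app P)
  refine ⟨((VectGUnion.isGluedFrom_iff_hasCocycle hP.1 hP.2.1).2 hA).hasCocycle_base hP.1 hP.2.1,
    fun A => (VectGUnion.isGluedFrom_iff_hasCocycle hP.1 hP.2.1).trans ⟨fun h => ?_, ?_⟩⟩
  · obtain ⟨f⟩ := PrincipalBundle.HasCocycle.nonempty_iso hA h
    exact ⟨Φ.preimageIso f⟩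
  · rintro ⟨f⟩
    exact hA.of_hom (Φ.map f.hom)
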